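/- Let $\Lambda$ be a finite or countably infinite set and let $A=(A_{x,y})_{x,y\in\Lambda}$ be a conservative generator: $A_{x,y}\ge 0$ for $x\ne y$ and $\sum_{y}A_{x,y}=0$ for every $x$, with all entries finite. Let $(X_t)_{t\ge 0}$ be a right-continuous continuous-time Markov chain on $\Lambda$ (with the discrete topology) with generator $A$, that is, its transition probabilities $p_t(x,y)$ form a semigroup of stochastic matrices with $\lim_{t\downarrow 0}(p_t(x,y)-\delta_{x,y})/t=A_{x,y}$ for all $x,y$. Under $\mathbb P_a$ the chain starts at $X_0=a$. For $T>0$ and $x\in\Lambda$ let $\ell_T(x)=\int_0^T \mathbf 1_{\{X_s=x\}}\,ds$ be the local times and $R_T=\{X_s: s\in[0,T]\}$ the range. For a finite set $R\subseteq\Lambda$ put $\mathcal M_T^+(R)=\{l\colon R\to(0,\infty) : \sum_{x\in R} l(x)=T\}$, and let $\sigma_T$ be the Lebesgue measure on $\mathcal M_T^+(R)$ for which Lebesgue measure on $(0,\infty)^R$ disintegrates as $d^Rl=\int_0^\infty dT\,\sigma_T(dl)$; explicitly, for any $c\in R$, $\sigma_T$ is Lebesgue measure in the coordinates $(l_x)_{x\in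 R\setminus\{c\}}$ (a unit point mass if $|R|=1$). For $a,b\in R$ and a matrix $M$ let $\det^{(R)}_{ab}(M)$ be the determinant of the matrix $(\mathbf 1_{x\neq b}M_{x,y}\mathbf 1_{y\neq a}+\mathbf 1_{x=b,\,y=a})_{x,y\in R}$, and let $\partial_l$ be the diagonal matrix with entries $\partial_{l_x}$, so that $\det^{(R)}_{ab}(-A+\partial_l)$ is a linear differential operator with constant coefficients. **Theorem (density of the local times).** Let $R\subseteq\Lambda$ be finite and $a,b\in R$. For $l\in(0,\infty)^R$ let $$\rho^{(R)}_{ab}(l)=\det\nolimits^{(R)}_{ab}(-A+\partial_l)\int_{[0,2\pi]^R}\exp\Big(\sum_{x,y\in R}A_{x,y}\sqrt{l_x}\sqrt{l_y}\,e^{i(\theta_x-\theta_y)}\Big)\prod_{x\in R}\frac{d\theta_x}{2\pi}.$$ Then, for every $T>0$, $\rho^{(R)}_{ab}$ is integrable with respect to $\sigma_T$, and for every bounded measurable $F\colon\mathcal M_T^+(R)\to\mathbb R$, $$\mathbb E_a\big[F\big((\ell_T(x))_{x\in R}\big)\mathbf 1_{\{X_T=b\}}\mathbf 1_{\{R_T=R\}}\big]=\int_{\mathcal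 M_T^+(R)}F(l)\,\rho^{(R)}_{ab}(l)\,\sigma_T(dl).$$ (On $\{X_T=b,\,R_T=R\}$ the vector $(\ell_T(x))_{x\in R}$ lies in $\mathcal M_T^+(R)$ almost surely.) -/

import Mathlib

open MeasureTheory Filter Topology
open scoped NNReal ENNReal

noncomputable section

namespace LocalTimes

section Chain

variable {Λ : Type*} [DecidableEq Λ]

/-- A conservative generator (Q-matrix): nonnegative off-diagonal entries and zero row sums. -/
structure IsConservativeGenerator (A : Matrix Λ Λ ℝ) : Prop where
  offDiag_nonneg : ∀ x y, x ≠ y → 0 ≤ A x y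
  row_sum : ∀ x, HasSum (fun y => A x y) 0

/-- A (time-homogeneous, honest) transition function on `Λ`: a semigroup of stochastic matrices. -/
structure IsTransitionFunction (p : ℝ≥0 → Matrix Λ Λ ℝ) : Prop where
  nonneg : ∀ t x y, 0 ≤ p t x y
  row_sum : ∀ t x, HasSum (fun y => p t x y) 1
  zero : p 0 = 1
  chapman_kolmogorov : ∀ s t x y, HasSum (fun z => p s x z * p t z y) (p (s + t) x y)

/-- `A` is the entrywise right derivative at time `0` of the transition function `p`. -/
def HasGenerator (p : ℝ≥0 → Matrix Λ Λ ℝ) (A : Matrix Λ Λ ℝ) : Prop :=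
  ∀ x y, Tendsto (fun t : ℝ≥0 => (p t x y - (1 : Matrix Λ Λ ℝ) x y) / (t : ℝ))
    (𝓝[>] 0) (𝓝 (A x y))

/-- `X` is, under the law `P`, a continuous-time Markov chain on the discrete set `Λ` with
generator `A`, started at `a`: its finite-dimensional distributions are those of a transition
function with generator `A`, and almost every path is right-continuous for the discrete
topology. -/
structure IsMarkovChain {Ω : Type*} [MeasurableSpace Ω] (P : Measure Ω)
    (A : Matrix Λ Λ ℝ) (a : Λ) (X : ℝ≥0 → Ω → Λ) : Prop where
  measurable : ∀ t x, MeasurableSet {ω | X t ω = x}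
  right_continuous : ∀ᵐ ω ∂P, ∀ t, ∀ᶠ s in 𝓝[≥] t, X s ω = X t ω
  markov : ∃ p : ℝ≥0 → Matrix Λ Λ ℝ, IsTransitionFunction p ∧ HasGenerator p A ∧
    ∀ (n : ℕ) (t : ℕ → ℝ≥0) (x : ℕ → Λ), Monotone t → t 0 = 0 → x 0 = a →
      P.real {ω | ∀ i ≤ n, X (t i) ω = x i} =
        ∏ i ∈ Finset.range n, p (t (i + 1) - t i) (x i) (x (i + 1))

/-- The local time `ℓ_T(x) = ∫_0^T 1{X_s = x} ds`. -/
def localTime {Ω : Type*} (X : ℝ≥0 → Ω → Λ) (T : ℝ≥0) (x : Λ) (ω : Ω) : ℝ :=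
  ∫ s in (0 : ℝ)..T, if X s.toNNReal ω = x then 1 else 0

/-- The range `{X_s : s ∈ [0, T]}`. -/
def chainRange {Ω : Type*} (X : ℝ≥0 → Ω → Λ) (T : ℝ≥0) (ω : Ω) : Set Λ :=
  (fun s => X s ω) '' Set.Icc 0 T

end Chain

section Density

variable {ι : Type*} [Fintype ι] [DecidableEq ι]

/-- The open simplex `{l : ι → (0, ∞) | ∑ l = T}`. -/
def openSimplex (ι : Type*) [Fintype ι] (T : ℝ) : Set (ι → ℝ) :=
  {l | (∀ x, 0 < l x) ∧ ∑ x, l x = T}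

/-- The point of the hyperplane `∑ l = T` whose coordinates other than `c` are given by `u`. -/
def hyperplanePoint (c : ι) (T : ℝ) (u : {x : ι // x ≠ c} → ℝ) : ι → ℝ :=
  fun x => if h : x = c then T - ∑ y, u y else u ⟨x, h⟩

/-- The Lebesgue measure `σ_T` on the open simplex: Lebesgue measure in the coordinates other
than `c`, carried to the simplex. It disintegrates Lebesgue measure on the positive orthant along
`l ↦ ∑ l`, see `lintegral_simplexMeasure`. -/
def simplexMeasure (c : ι) (T : ℝ) : Measure (ι → ℝ) :=
  ((volume : Measure ({x : ι // x ≠ c} → ℝ)).map (hyperplanePoint c T)).restrict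
    (openSimplex ι T)

theorem measurable_hyperplanePoint (c : ι) (T : ℝ) : Measurable (hyperplanePoint c T) := by
  refine measurable_pi_lambda _ fun x => ?_
  by_cases h : x = c
  · simp only [hyperplanePoint, h, dite_true]
    fun_prop
  · simp only [hyperplanePoint, h, dite_false]
    fun_prop

theorem sum_hyperplanePoint (c : ι) (T : ℝ) (u : {x : ι // x ≠ c} → ℝ) :
    ∑ x, hyperplanePoint c T u x = T := by
  rw [Fintype.sum_eq_add_sum_subtype_ne _ c]
  have h : ∀ y : {x : ι // x ≠ c}, hyperplanePoint c T u y = u y := fun y => by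
    simp [hyperplanePoint, y.2]
  simp only [h]
  simp [hyperplanePoint]

/-- The measures `σ_T` disintegrate Lebesgue measure on `(0, ∞)^ι`:
`∫ F(l) dl = ∫_0^∞ dT ∫ F(l) σ_T(dl)`. -/
theorem lintegral_simplexMeasure (c : ι) (F : (ι → ℝ) → ℝ≥0∞) (hF : Measurable F) :
    ∫⁻ l in {l : ι → ℝ | ∀ x, 0 < l x}, F l =
      ∫⁻ T in Set.Ioi (0 : ℝ), ∫⁻ l, F l ∂(simplexMeasure c T) := by
  have hO : MeasurableSet {l : ι → ℝ | ∀ x, 0 < l x} := by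
    simp only [Set.ofPred_forall]
    exact MeasurableSet.iInter fun x => measurableSet_lt measurable_const (measurable_pi_apply x)
  have hS : ∀ T, MeasurableSet (openSimplex ι T) := fun T =>
    hO.inter (measurableSet_eq_fun (by fun_prop) measurable_const)
  set G : (ι → ℝ) → ℝ≥0∞ := Set.indicator {l : ι → ℝ | ∀ x, 0 < l x} F with hG
  have hGm : Measurable G := hF.indicator hO
  have key : ∀ T, ∫⁻ l, F l ∂(simplexMeasure c T) =
      ∫⁻ u : {x : ι // x ≠ c} → ℝ, G (hyperplanePoint c T u) := by
    intro T
    rw [simplexMeasure, ← lintegral_indicator (hS T),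
      lintegral_map (hF.indicator (hS T)) (measurable_hyperplanePoint c T)]
    refine lintegral_congr fun u => ?_
    by_cases h : ∀ x, 0 < hyperplanePoint c T u x
    · rw [hG, Set.indicator_of_mem (s := {l : ι → ℝ | ∀ x, 0 < l x}) h,
        Set.indicator_of_mem (s := openSimplex ι T) ⟨h, sum_hyperplanePoint c T u⟩]
    · rw [hG, Set.indicator_of_notMem (s := {l : ι → ℝ | ∀ x, 0 < l x}) h,
        Set.indicator_of_notMem (s := openSimplex ι T) fun h' => h h'.1]
  have hzero : ∀ T ≤ 0, ∀ u : {x : ι // x ≠ c} → ℝ, G (hyperplanePoint c T u) = 0 := by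
    intro T hT u
    rw [hG, Set.indicator_of_notMem]
    intro h
    have h1 : 0 < ∑ x, hyperplanePoint c T u x :=
      Finset.sum_pos (fun x _ => h x) ⟨c, Finset.mem_univ c⟩
    rw [sum_hyperplanePoint] at h1
    exact absurd h1 (not_lt.2 hT)
  let e₁ := MeasurableEquiv.piEquivPiSubtypeProd (fun _ : ι => ℝ) (fun x => x = c)
  have he₁ : MeasurePreserving e₁ := by
    convert volume_preserving_piEquivPiSubtypeProd (fun _ : ι => ℝ) (fun x => x = c)
  let e₂ : ({x : ι // x = c} → ℝ) ≃ᵐ ℝ := MeasurableEquiv.funUnique _ _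
  have he₂ : MeasurePreserving e₂ := volume_preserving_funUnique _ _
  let K : ℝ × ({x : ι // x ≠ c} → ℝ) → (ι → ℝ) :=
    fun q x => if h : x = c then q.1 else q.2 ⟨x, h⟩
  have hK : Measurable K := by
    refine measurable_pi_lambda _ fun x => ?_
    by_cases h : x = c
    · simp only [K, h, dite_true]
      fun_prop
    · simp only [K, h, dite_false]
      fun_prop
  have hmp : MeasurePreserving
      (fun l : ι → ℝ => ((l c, fun x => l x) : ℝ × ({x : ι // x ≠ c} → ℝ))) :=
    (he₂.prod (MeasurePreserving.id (volume : Measure ({x : ι // x ≠ c} → ℝ)))).comp he₁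
  have hKl : ∀ l : ι → ℝ, K (l c, fun x => l x) = l := by
    intro l
    funext x
    by_cases h : x = c
    · subst h; simp [K]
    · simp [K, h]
  calc ∫⁻ l in {l : ι → ℝ | ∀ x, 0 < l x}, F l
      = ∫⁻ l, G l := (lintegral_indicator hO F).symm
    _ = ∫⁻ l : ι → ℝ, G (K (l c, fun x => l x)) := by simp only [hKl]
    _ = ∫⁻ q : ℝ × ({x : ι // x ≠ c} → ℝ), G (K q) :=
        hmp.lintegral_comp (hGm.comp hK)
    _ = ∫⁻ u : {x : ι // x ≠ c} → ℝ, ∫⁻ s : ℝ, G (K (s, u)) := by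
        rw [Measure.volume_eq_prod]
        exact lintegral_prod_symm' _ (hGm.comp hK)
    _ = ∫⁻ u : {x : ι // x ≠ c} → ℝ, ∫⁻ T : ℝ, G (K (T - ∑ y, u y, u)) := by
        refine lintegral_congr fun u => ?_
        exact (lintegral_sub_right_eq_self (fun s => G (K (s, u))) _).symm
    _ = ∫⁻ T : ℝ, ∫⁻ u : {x : ι // x ≠ c} → ℝ, G (K (T - ∑ y, u y, u)) := by
        refine lintegral_lintegral_swap (Measurable.aemeasurable ?_)
        exact (hGm.comp hK).comp
          (g := G ∘ K) (f := fun q : ({x : ι // x ≠ c} → ℝ) × ℝ => (q.2 - ∑ y, q.1 y, q.1))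
          (by fun_prop)
    _ = ∫⁻ T : ℝ, ∫⁻ u : {x : ι // x ≠ c} → ℝ, G (hyperplanePoint c T u) := rfl
    _ = ∫⁻ T in Set.Ioi (0 : ℝ), ∫⁻ l, F l ∂(simplexMeasure c T) := by
        rw [← lintegral_indicator measurableSet_Ioi]
        refine lintegral_congr fun T => ?_
        by_cases hT : 0 < T
        · rw [Set.indicator_of_mem (Set.mem_Ioi.2 hT), key]
        · rw [Set.indicator_of_notMem (by simpa using hT)]
          simp [hzero T (not_lt.1 hT)]

/-- The cofactor `det_ab(M)`: the determinant of
`(1_{x ≠ b} M_{x,y} 1_{y ≠ a} + 1_{x = b, y = a})_{x,y}`. -/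
def cofactor {S : Type*} [CommRing S] (a b : ι) (M : Matrix ι ι S) : S :=
  Matrix.det (Matrix.of fun x y =>
    (if x ≠ b ∧ y ≠ a then M x y else 0) + (if x = b ∧ y = a then 1 else 0))

/-- The partial derivative `∂_{l_x}`. -/
def partialDeriv (x : ι) (f : (ι → ℝ) → ℂ) : (ι → ℝ) → ℂ :=
  fun l => lineDeriv ℝ f l (Pi.single x 1)

/-- The mixed partial derivative `∏_x ∂_{l_x} ^ (m x)`, the factors being composed in an arbitrary
order, which is irrelevant where `f` is smooth. -/
def mixedPartial (m : ι →₀ ℕ) (f : (ι → ℝ) → ℂ) : (ι → ℝ) → ℂ :=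
  (Finsupp.toMultiset m).toList.foldr partialDeriv f

/-- The constant-coefficient differential operator `q(∂_l)` obtained by substituting `∂_{l_x}`
for the variable `X x` of the polynomial `q`. -/
def diffOp (q : MvPolynomial ι ℝ) (f : (ι → ℝ) → ℂ) : (ι → ℝ) → ℂ :=
  fun l => ∑ m ∈ q.support, ((q.coeff m : ℝ) : ℂ) * mixedPartial m f l

/-- The matrix `M + diag(X_x)` over the polynomial ring; substituting `∂_{l_x}` for `X_x` turns it
into the matrix `M + ∂_l` of differential operators. -/
def symbolMatrix (M : Matrix ι ι ℝ) : Matrix ι ι (MvPolynomial ι ℝ) :=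
  M.map MvPolynomial.C + Matrix.diagonal MvPolynomial.X

/-- `∫_{[0,2π]^ι} exp(∑_{x,y} A_{x,y} √l_x √l_y e^{i(θ_x - θ_y)}) ∏_x dθ_x / (2π)`. -/
def angularIntegral (A : Matrix ι ι ℝ) (l : ι → ℝ) : ℂ :=
  (∫ θ in Set.univ.pi fun _ : ι => Set.Icc (0 : ℝ) (2 * Real.pi),
    Complex.exp (∑ x, ∑ y, (A x y : ℂ) * (√(l x) : ℂ) * (√(l y) : ℂ) *
      Complex.exp (Complex.I * ((θ x : ℂ) - (θ y : ℂ))))) /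
    (2 * (Real.pi : ℂ)) ^ Fintype.card ι

/-- `det_ab(-A + ∂_l)` applied to the angular integral. -/
def density (A : Matrix ι ι ℝ) (a b : ι) : (ι → ℝ) → ℂ :=
  diffOp (cofactor a b (symbolMatrix (-A))) (angularIntegral A)

end Density

end LocalTimes

end

/-!
Fix `T` and characterise both sides by their characteristic functions, i.e. by inserting
`exp (i ∑ v_x l_x)`.

On the chain side, restricting the range to lie in `S ⊆ R` gives the Feynman-Kac exponential
`exp (T (A_S + i diag v))_{ab}`, the limit of `n`-step products of the killed transition matrices.
Inclusion-exclusion over `S` leaves the paths with range exactly `R`: the coefficient of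
`T ^ N / N!` is the total weight of the `N`-step paths from `a` to `b` that visit every state
of `R`, in the matrix `B = A_R + i diag v`.

On the density side, a complex shift of the phases rewrites the angular integral as the phase
average of `exp (∑ l_y D_y)`, where `D_y` is a phase-dependent column ratio not involving `l`.
The operator `det_ab(-A + ∂_l)` then acts as multiplication by the cofactor of `diag D - A`,
and the factor `exp (i ∑ v_x l_x)` is absorbed by replacing `A` with `B`. Integrating over the
simplex turns powers of `l` into complete homogeneous polynomials in the `D_y`; averaging over
the phases one state at a time shows that the coefficients are the same path weights.
-/

noncomputable section

namespace LocalTimes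

section Angle

variable {E : Type*} [NormedAddCommGroup E]

/-- The uniform probability measure on the angles `[0, 2π]`, the law of one phase `θ_x` of the
angular integral. -/
def angleMeasure : Measure ℝ :=
  ENNReal.ofReal (2 * Real.pi)⁻¹ • volume.restrict (Set.Icc 0 (2 * Real.pi))

instance : IsProbabilityMeasure angleMeasure := by
  have two_pi_pos : 0 < 2 * Real.pi := Real.two_pi_pos
  refine ⟨?_⟩
  simp only [angleMeasure, Measure.smul_apply, Measure.restrict_apply_univ, Real.volume_Icc,
    smul_eq_mul, sub_zero]
  rw [← ENNReal.ofReal_mul (inv_nonneg.2 two_pi_pos.le), inv_mul_cancel₀ two_pi_pos.ne',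
    ENNReal.ofReal_one]

theorem integral_angleMeasure_circleMap [NormedSpace ℝ E] (f : ℂ → E) (c : ℂ) (r : ℝ) :
    ∫ t, f (circleMap c r t) ∂angleMeasure = Real.circleAverage f c r := by
  rw [Real.circleAverage_def, angleMeasure, integral_smul_measure,
    intervalIntegral.integral_of_le Real.two_pi_pos.le, integral_Icc_eq_integral_Ioc,
    ENNReal.toReal_ofReal (inv_nonneg.2 Real.two_pi_pos.le)]

theorem circleAverage_eq_of_differentiableAt_of_ne [NormedSpace ℂ E]
    {f : ℂ → E} {c : ℂ} (hf : ∀ z ≠ c, DifferentiableAt ℂ f z) {r s : ℝ} (hr : 0 < r)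
    (hs : 0 < s) :
    Real.circleAverage f c r = Real.circleAverage f c s := by
  wlog hrs : r ≤ s generalizing r s
  · exact (this hs hr (le_of_not_ge hrs)).symm
  rw [Real.circleAverage_eq_circleIntegral hr.ne', Real.circleAverage_eq_circleIntegral hs.ne',
    Complex.circleIntegral_sub_center_inv_smul_eq_of_differentiable_on_annulus_off_countable hr hrs
      Set.countable_empty]
  · refine fun z hz => (hf z ?_).continuousAt.continuousWithinAt
    rintro rfl
    exact hz.2 (Metric.mem_ball_self hr)
  · refine fun z hz => hf z ?_
    rintro rfl
    exact hz.1.2 (Metric.mem_closedBall_self hr.le)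

end Angle

section PolarPoint

variable {ι : Type*}

/-- The point of `ℂ^ι` with polar coordinates `r` and `θ`, that is, `torusMap 0 r θ` for an
arbitrary index type. -/
def polarPoint (r θ : ι → ℝ) (x : ι) : ℂ := circleMap 0 (r x) (θ x)

theorem polarPoint_apply (r θ : ι → ℝ) (x : ι) :
    polarPoint r θ x = r x * Complex.exp (θ x * Complex.I) := by
  rw [polarPoint, circleMap_zero]

theorem polarPoint_apply_ne_zero {r : ι → ℝ} {x : ι} (hr : r x ≠ 0) (θ : ι → ℝ) :
    polarPoint r θ x ≠ 0 :=
  circleMap_ne_center hr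

theorem polarPoint_one_apply_ne_zero (θ : ι → ℝ) (x : ι) : polarPoint 1 θ x ≠ 0 :=
  polarPoint_apply_ne_zero (r := 1) one_ne_zero θ

theorem continuous_polarPoint (r : ι → ℝ) : Continuous (polarPoint r) :=
  continuous_pi fun x => (continuous_circleMap 0 (r x)).comp (continuous_apply x)

theorem polarPoint_update_update [DecidableEq ι] (r θ : ι → ℝ) (b : ι) (s t : ℝ) :
    polarPoint (Function.update r b s) (Function.update θ b t) =
      Function.update (polarPoint r θ) b (circleMap 0 s t) := by
  funext x
  rcases eq_or_ne x b with rfl | hx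
  · simp only [polarPoint, Function.update_self]
  · simp only [polarPoint, Function.update_of_ne hx]

end PolarPoint

section Torus

variable {ι : Type*} [Fintype ι] {E : Type*} [NormedAddCommGroup E]

/-- The uniform probability measure on `[0, 2π]^ι`, the joint law of the phases of the angular
integral. -/
def torusMeasure (ι : Type*) [Fintype ι] : Measure (ι → ℝ) :=
  Measure.pi fun _ => angleMeasure

instance : IsProbabilityMeasure (torusMeasure ι) := by
  unfold torusMeasure
  infer_instance

theorem torusMeasure_eq_smul :
    torusMeasure ι = ENNReal.ofReal (2 * Real.pi)⁻¹ ^ Fintype.card ι •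
      volume.restrict (Set.univ.pi fun _ : ι => Set.Icc (0 : ℝ) (2 * Real.pi)) := by
  refine Measure.pi_eq fun s _ => ?_
  rw [Measure.smul_apply, smul_eq_mul, volume_pi, Measure.restrict_pi_pi, Measure.pi_pi]
  simp only [angleMeasure, Measure.smul_apply, smul_eq_mul, Finset.prod_mul_distrib,
    Finset.prod_const, Finset.card_univ]

theorem integral_torusMeasure (f : (ι → ℝ) → ℂ) :
    ∫ θ, f θ ∂torusMeasure ι =
      (∫ θ in Set.univ.pi fun _ : ι => Set.Icc (0 : ℝ) (2 * Real.pi), f θ) /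
        (2 * (Real.pi : ℂ)) ^ Fintype.card ι := by
  rw [torusMeasure_eq_smul, integral_smul_measure, ENNReal.toReal_pow,
    ENNReal.toReal_ofReal (inv_nonneg.2 Real.two_pi_pos.le), Complex.real_smul, div_eq_inv_mul]
  push_cast
  rw [inv_pow]

theorem integrable_torusMeasure {f : (ι → ℝ) → E} (hf : Continuous f) :
    Integrable f (torusMeasure ι) := by
  rw [torusMeasure_eq_smul]
  exact (hf.continuousOn.integrableOn_compact
    (isCompact_univ_pi fun _ => isCompact_Icc)).smul_measure (by simp)

theorem measurePreserving_update [DecidableEq ι] {X : ι → Type*} [∀ x, MeasurableSpace (X x)]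
    (μ : ∀ x, Measure (X x)) [∀ x, IsProbabilityMeasure (μ x)] (b : ι) :
    MeasurePreserving (fun q : (∀ x, X x) × X b => Function.update q.1 b q.2)
      ((Measure.pi μ).prod (μ b)) (Measure.pi μ) := by
  have measurable_update : Measurable fun q : (∀ x, X x) × X b => Function.update q.1 b q.2 := by
    refine measurable_pi_lambda _ fun x => ?_
    rcases eq_or_ne x b with rfl | hx
    · simpa only [Function.update_self] using measurable_snd
    · simp only [Function.update_of_ne hx]
      fun_prop
  refine ⟨measurable_update, (Measure.pi_eq fun s hs => ?_).symm⟩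
  have preimage_box : (fun q : (∀ x, X x) × X b => Function.update q.1 b q.2) ⁻¹' Set.univ.pi s =
      (Set.univ.pi (Function.update s b Set.univ)) ×ˢ s b := by
    ext ⟨θ, t⟩
    simp only [Set.mem_preimage, Set.mem_univ_pi, Set.mem_prod]
    rw [Function.forall_update_iff θ fun x y => y ∈ s x,
      Function.forall_update_iff s fun x A => θ x ∈ A]
    simp only [Set.mem_univ, true_and, and_comm]
  rw [Measure.map_apply measurable_update (MeasurableSet.univ_pi hs), preimage_box,
    Measure.prod_prod, Measure.pi_pi, ← Finset.prod_erase_mul _ _ (Finset.mem_univ b),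
    ← Finset.prod_erase_mul _ _ (Finset.mem_univ b), Function.update_self, measure_univ, mul_one]
  congr 1
  refine Finset.prod_congr rfl fun x hx => ?_
  rw [Function.update_of_ne (Finset.ne_of_mem_erase hx)]

theorem integral_torusMeasure_update [DecidableEq ι] [NormedSpace ℝ E] (b : ι)
    {f : (ι → ℝ) → E} (hf : Continuous f) :
    ∫ θ, f θ ∂torusMeasure ι =
      ∫ θ, ∫ t, f (Function.update θ b t) ∂angleMeasure ∂torusMeasure ι := by
  have h : MeasurePreserving (fun q : (ι → ℝ) × ℝ => Function.update q.1 b q.2)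
      ((torusMeasure ι).prod angleMeasure) (torusMeasure ι) :=
    measurePreserving_update (fun _ : ι => angleMeasure) b
  rw [← h.map_eq, integral_map h.measurable.aemeasurable hf.aestronglyMeasurable, integral_prod,
    h.map_eq]
  exact (h.integrable_comp hf.aestronglyMeasurable).2 (integrable_torusMeasure hf)

variable [NormedSpace ℂ E]

/-- The circle around `0` of the coordinate `b` may be shrunk or expanded since the integrand is
holomorphic in the punctured plane. -/
theorem integral_polarPoint_update_radius [DecidableEq ι] {f : (ι → ℂ) → E}
    (hf : ∀ w, (∀ x, w x ≠ 0) → DifferentiableAt ℂ f w) {r : ι → ℝ} (hr : ∀ x, 0 < r x) (b : ι)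
    {s : ℝ} (hs : 0 < s) :
    ∫ θ, f (polarPoint (Function.update r b s) θ) ∂torusMeasure ι =
      ∫ θ, f (polarPoint r θ) ∂torusMeasure ι := by
  have continuous_comp : ∀ r : ι → ℝ, (∀ x, 0 < r x) → Continuous fun θ => f (polarPoint r θ) :=
    fun r hr => continuous_iff_continuousAt.2 fun θ =>
      (hf _ fun x => polarPoint_apply_ne_zero (hr x).ne' θ).continuousAt.comp
        (continuous_polarPoint r).continuousAt
  have update_pos : ∀ x, 0 < Function.update r b s x :=
    (Function.forall_update_iff r fun _ y => 0 < y).2 ⟨hs, fun x _ => hr x⟩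
  rw [integral_torusMeasure_update b (continuous_comp _ update_pos),
    integral_torusMeasure_update b (continuous_comp _ hr)]
  refine integral_congr_ae (ae_of_all _ fun θ => ?_)
  let slice : ℂ → E := fun z => f (Function.update (polarPoint r θ) b z)
  have differentiableAt_slice : ∀ z ≠ 0, DifferentiableAt ℂ slice z := by
    intro z hz
    refine (hf _ ?_).comp z (hasDerivAt_update _ b z).differentiableAt
    exact (Function.forall_update_iff _ fun _ y => y ≠ 0).2
      ⟨hz, fun x _ => polarPoint_apply_ne_zero (hr x).ne' θ⟩
  calc ∫ t, f (polarPoint (Function.update r b s) (Function.update θ b t)) ∂angleMeasure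
      = ∫ t, slice (circleMap 0 s t) ∂angleMeasure := by
        simp only [polarPoint_update_update, slice]
    _ = ∫ t, slice (circleMap 0 (r b) t) ∂angleMeasure := by
        rw [integral_angleMeasure_circleMap, integral_angleMeasure_circleMap]
        exact circleAverage_eq_of_differentiableAt_of_ne differentiableAt_slice hs (hr b)
    _ = ∫ t, f (polarPoint r (Function.update θ b t)) ∂angleMeasure := by
        simp only [slice, ← polarPoint_update_update _ _ _ (r b), Function.update_eq_self]

theorem integral_polarPoint_eq {f : (ι → ℂ) → E}
    (hf : ∀ w, (∀ x, w x ≠ 0) → DifferentiableAt ℂ f w) {r : ι → ℝ} (hr : ∀ x, 0 < r x) :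
    ∫ θ, f (polarPoint r θ) ∂torusMeasure ι = ∫ θ, f (polarPoint 1 θ) ∂torusMeasure ι := by
  classical
  suffices h : ∀ S : Finset ι, ∫ θ, f (polarPoint (S.piecewise r 1) θ) ∂torusMeasure ι =
      ∫ θ, f (polarPoint 1 θ) ∂torusMeasure ι by
    simpa only [Finset.piecewise_univ] using h Finset.univ
  intro S
  induction S using Finset.induction_on with
  | empty => rw [Finset.piecewise_empty]
  | insert b S _ ih =>
    rw [Finset.piecewise_insert, integral_polarPoint_update_radius hf _ b (hr b), ih]
    exact fun x => S.piecewise_cases r 1 (fun y => 0 < y) (hr x) one_pos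

end Torus

section ColumnRatio

variable {ι : Type*}

/-- The quotient `(∑_{x ∈ S} w_x B_{x,y}) / w_y`. On the torus this is the function
`∑_x B_{x,y} e^{i(θ_x - θ_y)}` that multiplies `l_y` in the exponent of the angular integral, once
the radii `√l_x` have been removed by a shift of contours. -/
def columnRatio (B : Matrix ι ι ℂ) (S : Finset ι) (w : ι → ℂ) (y : ι) : ℂ :=
  ∑ x ∈ S, w x * B x y * (w y)⁻¹

theorem differentiableAt_columnRatio [Finite ι] (B : Matrix ι ι ℂ) (S : Finset ι) {w : ι → ℂ}
    (hw : ∀ x, w x ≠ 0) : DifferentiableAt ℂ (columnRatio B S) w := by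
  have := Fintype.ofFinite ι
  refine differentiableAt_pi.2 fun y => DifferentiableAt.fun_sum fun x _ => ?_
  exact ((differentiableAt_apply x w).mul_const _).mul ((differentiableAt_apply y w).inv (hw y))

theorem continuous_columnRatio_polarPoint [Finite ι] (B : Matrix ι ι ℂ) (S : Finset ι) :
    Continuous fun θ : ι → ℝ => columnRatio B S (polarPoint 1 θ) :=
  continuous_iff_continuousAt.2 fun θ =>
    (differentiableAt_columnRatio B S (polarPoint_one_apply_ne_zero θ)).continuousAt.comp
      (continuous_polarPoint 1).continuousAt

theorem columnRatio_update [DecidableEq ι] (B : Matrix ι ι ℂ) {S : Finset ι} {b y : ι} (hb : b ∈ S)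
    (hy : y ≠ b) (w : ι → ℂ) (z : ℂ) :
    columnRatio B S (Function.update w b z) y =
      z * (B b y * (w y)⁻¹) + columnRatio B (S.erase b) w y := by
  simp only [columnRatio, Function.update_of_ne hy]
  rw [← Finset.add_sum_erase _ _ hb, Function.update_self, mul_assoc]
  congr 1
  refine Finset.sum_congr rfl fun x hx => ?_
  rw [Function.update_of_ne (Finset.ne_of_mem_erase hx)]

variable [Fintype ι] {E : Type*} [NormedAddCommGroup E]

theorem integrable_comp_columnRatio (B : Matrix ι ι ℂ) (S : Finset ι) {Q : (ι → ℂ) → E}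
    (hQ : Continuous Q) :
    Integrable (fun θ => Q (columnRatio B S (polarPoint 1 θ))) (torusMeasure ι) :=
  integrable_torusMeasure (hQ.comp (continuous_columnRatio_polarPoint B S))

/-- Only nonnegative powers of `w b` occur when `Q` ignores its argument `b`, so the average over
the phase at `b` is the value at `w b = 0`. -/
theorem integral_columnRatio_erase [DecidableEq ι] [NormedSpace ℂ E] [CompleteSpace E]
    (B : Matrix ι ι ℂ) {S : Finset ι} {b : ι} (hb : b ∈ S) {Q : (ι → ℂ) → E}
    (hQ : Differentiable ℂ Q) (hQb : ∀ D D' : ι → ℂ, (∀ x ≠ b, D x = D' x) → Q D = Q D') :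
    ∫ θ, Q (columnRatio B S (polarPoint 1 θ)) ∂torusMeasure ι =
      ∫ θ, Q (columnRatio B (S.erase b) (polarPoint 1 θ)) ∂torusMeasure ι := by
  rw [integral_torusMeasure_update b (f := fun θ => Q (columnRatio B S (polarPoint 1 θ)))
    (hQ.continuous.comp (continuous_columnRatio_polarPoint B S))]
  refine integral_congr_ae (ae_of_all _ fun θ => ?_)
  let slice : ℂ → E := fun z => Q fun y =>
    z * (B b y * (polarPoint 1 θ y)⁻¹) + columnRatio B (S.erase b) (polarPoint 1 θ) y
  have differentiable_slice : Differentiable ℂ slice :=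
    hQ.comp (differentiable_pi.2 fun y => by fun_prop)
  calc ∫ t, Q (columnRatio B S (polarPoint 1 (Function.update θ b t))) ∂angleMeasure
      = ∫ t, slice (circleMap 0 1 t) ∂angleMeasure := by
        refine integral_congr_ae (ae_of_all _ fun t => hQb _ _ fun y hy => ?_)
        rw [← columnRatio_update B hb hy]
        have update_angle := polarPoint_update_update 1 θ b ((1 : ι → ℝ) b) t
        rw [Function.update_eq_self] at update_angle
        rw [update_angle, Pi.one_apply]
    _ = slice 0 := by
        rw [integral_angleMeasure_circleMap, differentiable_slice.diffContOnCl.circleAverage]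
    _ = Q (columnRatio B (S.erase b) (polarPoint 1 θ)) := by
        simp only [slice, zero_mul, zero_add]

end ColumnRatio

section Cofactors

variable {ι : Type*} [DecidableEq ι] {K : Type*} [CommRing K]

/-- The matrix `M` with row and column `b` replaced by those of the identity, which decouples the
state `b` from the others. -/
def isolate (M : Matrix ι ι K) (b : ι) : Matrix ι ι K :=
  (M.updateRow b (Pi.single b 1)).updateCol b (Pi.single b 1)

variable [Fintype ι]

theorem det_updateCol_of_row_eq_single {M : Matrix ι ι K} {a b : ι} (h : M b = Pi.single a 1) :
    (M.updateCol a (Pi.single b 1)).det = M.det := by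
  have updateCol_add_sub : M = M.updateCol a (Pi.single b 1 + (M.col a - Pi.single b 1)) := by
    rw [add_sub_cancel]
    exact (Matrix.updateCol_eq_self M a).symm
  conv_rhs => rw [updateCol_add_sub, Matrix.det_updateCol_add]
  rw [left_eq_add]
  refine Matrix.det_eq_zero_of_row_eq_zero b fun y => ?_
  rcases eq_or_ne y a with rfl | hy
  · simp [h, Matrix.col]
  · simp [h, hy]

theorem cofactor_eq_adjugate (a b : ι) (M : Matrix ι ι K) :
    cofactor a b M = M.adjugate a b := by
  rw [Matrix.adjugate_apply, cofactor, ← det_updateCol_of_row_eq_single (a := a) (b := b)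
    (M := M.updateRow b (Pi.single a 1)) Matrix.updateRow_self]
  congr 1
  ext x y
  by_cases hx : x = b <;> by_cases hy : y = a <;> simp [hx, hy, Matrix.updateRow_apply]

theorem adjugate_self_eq_det_isolate (M : Matrix ι ι K) (b : ι) :
    M.adjugate b b = (isolate M b).det := by
  rw [Matrix.adjugate_apply, isolate, det_updateCol_of_row_eq_single Matrix.updateRow_self]

theorem adjugate_updateRow_self (M : Matrix ι ι K) (a b : ι) (v : ι → K) :
    (M.updateRow b v).adjugate a b = M.adjugate a b := by
  rw [Matrix.adjugate_apply, Matrix.adjugate_apply, Matrix.updateRow_idem]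

theorem adjugate_updateRow_single (M : Matrix ι ι K) {a b y : ι} (ha : a ≠ b) (hy : y ≠ b) :
    (M.updateRow b (Pi.single b 1)).adjugate a y = (isolate M b).adjugate a y := by
  set M' := M.updateRow b (Pi.single b 1) with hM'
  have row_eq_single : M'.updateRow y (Pi.single a 1) b = Pi.single b 1 := by
    rw [Matrix.updateRow_ne hy.symm, hM', Matrix.updateRow_self]
  rw [Matrix.adjugate_apply, Matrix.adjugate_apply,
    ← det_updateCol_of_row_eq_single row_eq_single]
  congr 1
  ext x z
  rcases eq_or_ne x y with rfl | hx
  · rcases eq_or_ne z b with rfl | hz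
    · simp [hy, ha.symm]
    · simp [hz]
  · simp [isolate, hx, M', Matrix.updateCol_apply]

theorem adjugate_eq_neg_sum_adjugate_isolate (M : Matrix ι ι K) {a b : ι} (hab : a ≠ b) :
    M.adjugate a b = -∑ y ∈ Finset.univ.erase b, (isolate M b).adjugate a y * M y b := by
  set M' := M.updateRow b (Pi.single b 1) with hM'
  have adjugate_mul_apply : ∑ y, M'.adjugate a y * M' y b = 0 := by
    rw [← Matrix.mul_apply, Matrix.adjugate_mul, Matrix.smul_apply, Matrix.one_apply_ne hab,
      smul_zero]
  rw [← Finset.add_sum_erase _ _ (Finset.mem_univ b), hM', adjugate_updateRow_self,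
    Matrix.updateRow_self, Pi.single_eq_same, mul_one] at adjugate_mul_apply
  rw [eq_neg_of_add_eq_zero_left adjugate_mul_apply]
  congr 1
  refine Finset.sum_congr rfl fun y hy => ?_
  have hy := Finset.ne_of_mem_erase hy
  rw [adjugate_updateRow_single M hab hy, Matrix.updateRow_ne hy]

end Cofactors

section CompleteHomogeneous

variable {ι K : Type*} [DecidableEq ι] [CommSemiring K]

/-- The complete homogeneous symmetric polynomial of degree `n` in the variables `D x`, `x ∈ S`. -/
def completeHomogeneous (S : Finset ι) (n : ℕ) (D : ι → K) : K :=
  ∑ k ∈ S.piAntidiag n, ∏ x ∈ S, D x ^ k x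

theorem completeHomogeneous_zero (S : Finset ι) (D : ι → K) : completeHomogeneous S 0 D = 1 := by
  simp [completeHomogeneous]

theorem completeHomogeneous_empty_succ (n : ℕ) (D : ι → K) :
    completeHomogeneous ∅ (n + 1) D = 0 := by
  simp [completeHomogeneous]

theorem completeHomogeneous_cons {S : Finset ι} {b : ι} (hb : b ∉ S) (n : ℕ) (D : ι → K) :
    completeHomogeneous (S.cons b hb) n D =
      ∑ p ∈ Finset.HasAntidiagonal.antidiagonal n, D b ^ p.1 * completeHomogeneous S p.2 D := by
  unfold completeHomogeneous
  rw [Finset.piAntidiag_cons, Finset.sum_disjiUnion]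
  refine Finset.sum_congr rfl fun p _ => ?_
  rw [Finset.sum_map, Finset.mul_sum]
  refine Finset.sum_congr rfl fun k hk => ?_
  have apply_b_eq_zero : k b = 0 := by
    by_contra hkb
    exact hb ((Finset.mem_piAntidiag.1 hk).2 b hkb)
  rw [Finset.prod_cons]
  congr 1
  · simp [apply_b_eq_zero]
  · refine Finset.prod_congr rfl fun x hx => ?_
    simp [ne_of_mem_of_not_mem hx hb]

theorem completeHomogeneous_succ {S : Finset ι} {b : ι} (hb : b ∈ S) (n : ℕ) (D : ι → K) :
    completeHomogeneous S (n + 1) D =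
      D b * completeHomogeneous S n D + completeHomogeneous (S.erase b) (n + 1) D := by
  obtain ⟨S, hbS, rfl⟩ : ∃ S', ∃ h : b ∉ S', S = Finset.cons b S' h :=
    ⟨S.erase b, Finset.notMem_erase b S, by simp [Finset.insert_erase hb]⟩
  rw [completeHomogeneous_cons, completeHomogeneous_cons, Finset.Nat.antidiagonal_succ,
    Finset.sum_cons, Finset.sum_map, Finset.mul_sum, Finset.cons_eq_insert,
    Finset.erase_insert hbS, add_comm, pow_zero, one_mul]
  congr 1
  refine Finset.sum_congr rfl fun p _ => ?_
  simp only [Function.Embedding.prodMap, Function.Embedding.coeFn_mk, Prod.map_fst, Prod.map_snd,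
    Function.Embedding.refl_apply, Nat.succ_eq_add_one, pow_succ', mul_assoc]

theorem differentiable_completeHomogeneous [Finite ι] (S : Finset ι) (n : ℕ) :
    Differentiable ℂ (completeHomogeneous (K := ℂ) S n) := by
  have := Fintype.ofFinite ι
  unfold completeHomogeneous
  fun_prop

/-- The weight of the ways to distribute `N + 1` visits over the states of `S`, each being visited
at least once, when every repeated visit of `x` has weight `D x`. It is the complete homogeneous
symmetric polynomial of degree `N + 1 - S.card`, and `0` when that difference is negative. -/
def holdingWeight (S : Finset ι) (N : ℕ) (D : ι → K) : K :=
  if S.card ≤ N + 1 then completeHomogeneous S (N + 1 - S.card) D else 0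

theorem holdingWeight_empty (N : ℕ) (D : ι → K) : holdingWeight ∅ N D = 0 := by
  simp [holdingWeight, completeHomogeneous_empty_succ]

theorem holdingWeight_succ {S : Finset ι} {b : ι} (hb : b ∈ S) (N : ℕ) (D : ι → K) :
    holdingWeight S (N + 1) D = D b * holdingWeight S N D + holdingWeight (S.erase b) N D := by
  have card_erase := Finset.card_erase_add_one hb
  unfold holdingWeight
  rcases lt_trichotomy S.card (N + 2) with h | h | h
  · rw [if_pos (by lia), if_pos (by lia), if_pos (by lia),
      show N + 1 + 1 - S.card = N + 1 - S.card + 1 by lia, completeHomogeneous_succ hb,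
      show N + 1 - (S.erase b).card = N + 1 - S.card + 1 by lia]
  · rw [if_pos (by lia), if_neg (by lia), if_pos (by lia),
      show N + 1 + 1 - S.card = 0 by lia, show N + 1 - (S.erase b).card = 0 by lia,
      completeHomogeneous_zero, completeHomogeneous_zero, mul_zero, zero_add]
  · rw [if_neg (by lia), if_neg (by lia), if_neg (by lia), mul_zero, zero_add]

theorem holdingWeight_congr {S : Finset ι} (N : ℕ) {D D' : ι → K} (h : ∀ x ∈ S, D x = D' x) :
    holdingWeight S N D = holdingWeight S N D' := by
  unfold holdingWeight completeHomogeneous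
  congr 1
  refine Finset.sum_congr rfl fun k _ => Finset.prod_congr rfl fun x hx => ?_
  rw [h x hx]

theorem differentiable_holdingWeight [Finite ι] (S : Finset ι) (N : ℕ) :
    Differentiable ℂ (holdingWeight (K := ℂ) S N) := by
  unfold holdingWeight
  split_ifs
  · exact differentiable_completeHomogeneous _ _
  · exact differentiable_const _

end CompleteHomogeneous

section MaskedMatrix

variable {ι K : Type*} [DecidableEq ι] [CommRing K]

/-- The matrix `diag D - B` on `S`, extended by the identity, so that its determinant and cofactors
are those of the submatrix on `S`. -/
def maskedMatrix (B : Matrix ι ι K) (S : Finset ι) (D : ι → K) : Matrix ι ι K :=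
  Matrix.of fun x y => if x ∈ S ∧ y ∈ S then (Matrix.diagonal D - B) x y else (1 : Matrix ι ι K) x y

variable {S : Finset ι}

theorem maskedMatrix_apply_of_mem (B : Matrix ι ι K) (D : ι → K) {x y : ι} (hx : x ∈ S)
    (hy : y ∈ S) : maskedMatrix B S D x y = (Matrix.diagonal D - B) x y :=
  if_pos ⟨hx, hy⟩

theorem maskedMatrix_apply_of_notMem_left (B : Matrix ι ι K) (D : ι → K) {x : ι} (hx : x ∉ S)
    (y : ι) : maskedMatrix B S D x y = (1 : Matrix ι ι K) x y :=
  if_neg fun h => hx h.1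

theorem maskedMatrix_apply_of_notMem_right (B : Matrix ι ι K) (D : ι → K) (x : ι) {y : ι}
    (hy : y ∉ S) : maskedMatrix B S D x y = (1 : Matrix ι ι K) x y :=
  if_neg fun h => hy h.2

theorem maskedMatrix_empty (B : Matrix ι ι K) (D : ι → K) : maskedMatrix B ∅ D = 1 := by
  ext x y
  exact maskedMatrix_apply_of_notMem_left B D (Finset.notMem_empty x) y

theorem maskedMatrix_univ [Fintype ι] (B : Matrix ι ι K) (D : ι → K) :
    maskedMatrix B Finset.univ D = Matrix.diagonal D - B := by
  ext x y
  exact maskedMatrix_apply_of_mem B D (Finset.mem_univ x) (Finset.mem_univ y)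

theorem maskedMatrix_congr (B : Matrix ι ι K) {D D' : ι → K} (h : ∀ x ∈ S, D x = D' x) :
    maskedMatrix B S D = maskedMatrix B S D' := by
  ext x y
  simp only [maskedMatrix, Matrix.of_apply]
  split_ifs with hxy
  · rcases eq_or_ne x y with rfl | hne
    · simp only [Matrix.sub_apply, Matrix.diagonal_apply_eq, h x hxy.1]
    · simp only [Matrix.sub_apply, Matrix.diagonal_apply_ne _ hne]
  · rfl

theorem isolate_maskedMatrix (B : Matrix ι ι K) (S : Finset ι) (D : ι → K) (b : ι) :
    isolate (maskedMatrix B S D) b = maskedMatrix B (S.erase b) D := by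
  ext x y
  by_cases hx : x = b <;> by_cases hy : y = b <;>
    simp [isolate, maskedMatrix, hx, hy, Matrix.updateRow_apply, Matrix.one_apply, Ne.symm, eq_comm]

theorem adjugate_maskedMatrix_eq_sum [Fintype ι] (B : Matrix ι ι K) {a b : ι} (hab : a ≠ b)
    (hb : b ∈ S) (D : ι → K) :
    (maskedMatrix B S D).adjugate a b =
      ∑ y ∈ S.erase b, (maskedMatrix B (S.erase b) D).adjugate a y * B y b := by
  rw [adjugate_eq_neg_sum_adjugate_isolate _ hab, isolate_maskedMatrix, ← Finset.sum_neg_distrib]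
  refine (Finset.sum_subset_zero_on_sdiff
    (Finset.erase_subset_erase b (Finset.subset_univ S)) ?_ ?_).symm
  · intro y hy
    simp only [Finset.mem_sdiff, Finset.mem_erase, Finset.mem_univ, and_true, not_and] at hy
    rw [maskedMatrix_apply_of_notMem_left B D (hy.2 hy.1), Matrix.one_apply_ne hy.1, mul_zero,
      neg_zero]
  · intro y hy
    obtain ⟨hyb, hy⟩ := Finset.mem_erase.1 hy
    rw [maskedMatrix_apply_of_mem B D hy hb, Matrix.sub_apply, Matrix.diagonal_apply_ne _ hyb,
      zero_sub, mul_neg, neg_neg]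

end MaskedMatrix

section CoveringWeight

variable {ι : Type*} [DecidableEq ι] (B : Matrix ι ι ℂ) {S : Finset ι}

theorem differentiable_maskedMatrix_apply [Finite ι] (S : Finset ι) (x y : ι) :
    Differentiable ℂ fun D => maskedMatrix B S D x y := by
  have := Fintype.ofFinite ι
  simp only [maskedMatrix, Matrix.of_apply]
  split_ifs
  · rcases eq_or_ne x y with rfl | h
    · simp only [Matrix.sub_apply, Matrix.diagonal_apply_eq]
      fun_prop
    · simp only [Matrix.sub_apply, Matrix.diagonal_apply_ne _ h]
      exact differentiable_const _
  · exact differentiable_const _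

variable [Fintype ι]

theorem differentiable_det {𝕜 E : Type*} [NontriviallyNormedField 𝕜] [NormedAddCommGroup E]
    [NormedSpace 𝕜 E] {M : E → Matrix ι ι 𝕜} (h : ∀ x y, Differentiable 𝕜 fun v => M v x y) :
    Differentiable 𝕜 fun v => (M v).det := by
  simp only [Matrix.det_apply]
  fun_prop

theorem differentiable_adjugate_maskedMatrix (S : Finset ι) (a b : ι) :
    Differentiable ℂ fun D => (maskedMatrix B S D).adjugate a b := by
  simp only [Matrix.adjugate_apply]
  refine differentiable_det fun x y => ?_
  simp only [Matrix.updateRow_apply]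
  split_ifs
  · exact differentiable_const _
  · exact differentiable_maskedMatrix_apply B S x y

theorem differentiable_adjugate_mul_holdingWeight (S S' : Finset ι) (N : ℕ) (a b : ι) :
    Differentiable ℂ fun D => (maskedMatrix B S D).adjugate a b * holdingWeight S' N D :=
  (differentiable_adjugate_maskedMatrix B S a b).mul (differentiable_holdingWeight _ N)

/-- The row vector `w` lies in the left kernel. -/
theorem det_maskedMatrix_columnRatio (hS : S.Nonempty) {w : ι → ℂ} (hw : ∀ x, w x ≠ 0) :
    (maskedMatrix B S (columnRatio B S w)).det = 0 := by
  rw [← Matrix.exists_vecMul_eq_zero_iff]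
  refine ⟨fun x => if x ∈ S then w x else 0, ?_, ?_⟩
  · obtain ⟨x, hx⟩ := hS
    intro h
    simpa only [if_pos hx, Pi.zero_apply, hw x] using congrFun h x
  · ext y
    simp only [Matrix.vecMul, dotProduct, Pi.zero_apply, ite_mul, zero_mul, Finset.sum_ite_mem,
      Finset.univ_inter]
    by_cases hy : y ∈ S
    · rw [Finset.sum_congr rfl fun x hx => by
          rw [maskedMatrix_apply_of_mem B _ hx hy, Matrix.sub_apply, mul_sub],
        Finset.sum_sub_distrib, Finset.sum_eq_single_of_mem y hy fun x _ hxy => by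
          rw [Matrix.diagonal_apply_ne _ hxy, mul_zero],
        Matrix.diagonal_apply_eq, columnRatio, Finset.mul_sum, sub_eq_zero]
      refine Finset.sum_congr rfl fun x _ => ?_
      rw [mul_comm (w x * B x y), mul_inv_cancel_left₀ (hw y)]
    · refine Finset.sum_eq_zero fun x hx => ?_
      rw [maskedMatrix_apply_of_notMem_right B _ x hy,
        Matrix.one_apply_ne (ne_of_mem_of_not_mem hx hy), mul_zero]

theorem adjugate_mul_columnRatio {b : ι} (hb : b ∈ S) (a : ι) {w : ι → ℂ} (hw : ∀ x, w x ≠ 0) :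
    (maskedMatrix B S (columnRatio B S w)).adjugate a b * columnRatio B S w b =
      ∑ y ∈ S, (maskedMatrix B S (columnRatio B S w)).adjugate a y * B y b := by
  set D := columnRatio B S w
  have adjugate_mul_apply :
      ∑ y ∈ S, (maskedMatrix B S D).adjugate a y * maskedMatrix B S D y b = 0 := by
    rw [Finset.sum_subset (Finset.subset_univ S), ← Matrix.mul_apply, Matrix.adjugate_mul,
      det_maskedMatrix_columnRatio B ⟨b, hb⟩ hw, zero_smul, Matrix.zero_apply]
    intro y _ hy
    rw [maskedMatrix_apply_of_notMem_left B D hy,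
      Matrix.one_apply_ne (ne_of_mem_of_not_mem hb hy).symm, mul_zero]
  rw [Finset.sum_congr rfl fun y hy => by
      rw [maskedMatrix_apply_of_mem B D hy hb, Matrix.sub_apply, mul_sub],
    Finset.sum_sub_distrib, Finset.sum_eq_single_of_mem b hb fun y _ hy => by
      rw [Matrix.diagonal_apply_ne _ hy, mul_zero],
    Matrix.diagonal_apply_eq] at adjugate_mul_apply
  exact sub_eq_zero.1 adjugate_mul_apply

/-- The total weight of the paths of `N` steps from `a` to `b` that visit exactly the states of `S`,
a step from `x` to `y` having weight `B x y`. It is given as the torus average that arises from the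
density of the local times; the recursion `coveringWeight_succ` and the initial value
`coveringWeight_zero` identify it with the sum over paths. -/
def coveringWeight (S : Finset ι) (N : ℕ) (a b : ι) : ℂ :=
  if a ∈ S ∧ b ∈ S then
    ∫ θ, (maskedMatrix B S (columnRatio B S (polarPoint 1 θ))).adjugate a b *
      holdingWeight S N (columnRatio B S (polarPoint 1 θ)) ∂torusMeasure ι
  else 0

theorem coveringWeight_of_mem {a b : ι} (ha : a ∈ S) (hb : b ∈ S) (N : ℕ) :
    coveringWeight B S N a b =
      ∫ θ, (maskedMatrix B S (columnRatio B S (polarPoint 1 θ))).adjugate a b *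
        holdingWeight S N (columnRatio B S (polarPoint 1 θ)) ∂torusMeasure ι :=
  if_pos ⟨ha, hb⟩

theorem coveringWeight_of_notMem_left {a : ι} (ha : a ∉ S) (N : ℕ) (b : ι) :
    coveringWeight B S N a b = 0 :=
  if_neg fun h => ha h.1

theorem coveringWeight_of_notMem_right {b : ι} (hb : b ∉ S) (N : ℕ) (a : ι) :
    coveringWeight B S N a b = 0 :=
  if_neg fun h => hb h.2

theorem sum_coveringWeight_mul {a : ι} (ha : a ∈ S) (N : ℕ) (v : ι → ℂ) :
    ∑ y, coveringWeight B S N a y * v y =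
      ∫ θ, (∑ y ∈ S, (maskedMatrix B S (columnRatio B S (polarPoint 1 θ))).adjugate a y * v y) *
        holdingWeight S N (columnRatio B S (polarPoint 1 θ)) ∂torusMeasure ι := by
  simp only [Finset.sum_mul]
  rw [← Finset.sum_subset (Finset.subset_univ S), integral_finsetSum]
  · refine Finset.sum_congr rfl fun y hy => ?_
    rw [coveringWeight_of_mem B ha hy, ← integral_mul_const]
    simp only [mul_right_comm]
  · intro y _
    exact integrable_comp_columnRatio B S
      (((differentiable_adjugate_maskedMatrix B S a y).mul_const (v y)).mul
        (differentiable_holdingWeight S N)).continuous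
  · intro y _ hy
    rw [coveringWeight_of_notMem_right B hy, zero_mul]

theorem integral_adjugate_self_mul_holdingWeight_erase {a : ι} (ha : a ∈ S) (N : ℕ) :
    ∫ θ, (maskedMatrix B S (columnRatio B S (polarPoint 1 θ))).adjugate a a *
      holdingWeight (S.erase a) N (columnRatio B S (polarPoint 1 θ)) ∂torusMeasure ι = 0 := by
  simp only [adjugate_self_eq_det_isolate, isolate_maskedMatrix]
  rw [integral_columnRatio_erase B ha
    (Q := fun D => (maskedMatrix B (S.erase a) D).det * holdingWeight (S.erase a) N D)
    ((differentiable_det (differentiable_maskedMatrix_apply B _)).mul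
      (differentiable_holdingWeight _ N))]
  · rcases (S.erase a).eq_empty_or_nonempty with h | h
    · simp [h, holdingWeight_empty]
    · simp [det_maskedMatrix_columnRatio B h (polarPoint_one_apply_ne_zero _)]
  · intro D D' h
    have eq_on_erase : ∀ x ∈ S.erase a, D x = D' x := fun x hx => h x (Finset.ne_of_mem_erase hx)
    rw [maskedMatrix_congr B eq_on_erase, holdingWeight_congr N eq_on_erase]

theorem integral_adjugate_mul_holdingWeight_erase {a b : ι} (ha : a ∈ S) (hb : b ∈ S) (N : ℕ) :
    ∫ θ, (maskedMatrix B S (columnRatio B S (polarPoint 1 θ))).adjugate a b *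
        holdingWeight (S.erase b) N (columnRatio B S (polarPoint 1 θ)) ∂torusMeasure ι =
      ∑ y, coveringWeight B (S.erase b) N a y * B y b := by
  rcases eq_or_ne a b with rfl | hab
  · rw [integral_adjugate_self_mul_holdingWeight_erase B ha]
    simp only [coveringWeight_of_notMem_left B (Finset.notMem_erase a S), zero_mul,
      Finset.sum_const_zero]
  · simp only [adjugate_maskedMatrix_eq_sum B hab hb]
    rw [sum_coveringWeight_mul B (Finset.mem_erase.2 ⟨hab, ha⟩)]
    refine integral_columnRatio_erase B hb
      (Q := fun D => (∑ y ∈ S.erase b, (maskedMatrix B (S.erase b) D).adjugate a y * B y b) *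
        holdingWeight (S.erase b) N D)
      (Differentiable.mul (Differentiable.fun_sum fun y _ => ?_)
        (differentiable_holdingWeight _ N)) fun D D' h => ?_
    · exact (differentiable_adjugate_maskedMatrix B _ a y).mul_const _
    · have eq_on_erase : ∀ x ∈ S.erase b, D x = D' x := fun x hx =>
        h x (Finset.ne_of_mem_erase hx)
      rw [maskedMatrix_congr B eq_on_erase, holdingWeight_congr N eq_on_erase]

/-- Before its last step to `b`, a path covering `S` has covered either `S` or `S.erase b`. -/
theorem coveringWeight_succ {b : ι} (hb : b ∈ S) (N : ℕ) (a : ι) :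
    coveringWeight B S (N + 1) a b =
      ∑ y, (coveringWeight B S N a y + coveringWeight B (S.erase b) N a y) * B y b := by
  by_cases ha : a ∈ S
  · simp only [add_mul, Finset.sum_add_distrib]
    rw [← integral_adjugate_mul_holdingWeight_erase B ha hb, sum_coveringWeight_mul B ha,
      coveringWeight_of_mem B ha hb, ← integral_add]
    · refine integral_congr_ae (ae_of_all _ fun θ => ?_)
      simp only [holdingWeight_succ hb, mul_add, ← mul_assoc,
        adjugate_mul_columnRatio B hb a (polarPoint_one_apply_ne_zero θ)]
    · refine integrable_comp_columnRatio B S (Q := fun D =>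
        (∑ y ∈ S, (maskedMatrix B S D).adjugate a y * B y b) * holdingWeight S N D)
        (Continuous.mul (continuous_finsetSum _ fun y _ => ?_)
          (differentiable_holdingWeight S N).continuous)
      exact ((differentiable_adjugate_maskedMatrix B S a y).mul_const _).continuous
    · exact integrable_comp_columnRatio B S
        (differentiable_adjugate_mul_holdingWeight B S (S.erase b) N a b).continuous
  · have ha' : a ∉ S.erase b := fun h => ha (Finset.mem_of_mem_erase h)
    simp only [coveringWeight_of_notMem_left B ha, coveringWeight_of_notMem_left B ha', add_zero,
      zero_mul, Finset.sum_const_zero]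

theorem coveringWeight_zero (S : Finset ι) (a b : ι) :
    coveringWeight B S 0 a b = if S = {a} ∧ a = b then 1 else 0 := by
  by_cases h : S = {a} ∧ a = b
  · obtain ⟨rfl, rfl⟩ := h
    simp [coveringWeight, holdingWeight, completeHomogeneous_zero, adjugate_self_eq_det_isolate,
      isolate_maskedMatrix, maskedMatrix_empty]
  · rw [if_neg h, coveringWeight]
    split_ifs with hab
    · have one_lt_card : ¬ S.card ≤ 0 + 1 := by
        intro hc
        have eq_of_mem := Finset.card_le_one.1 hc
        exact h ⟨Finset.eq_singleton_iff_unique_mem.2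
          ⟨hab.1, fun x hx => eq_of_mem x hx a hab.1⟩, eq_of_mem a hab.1 b hab.2⟩
      simp [holdingWeight, one_lt_card]
    · rfl

theorem sum_powerset_coveringWeight_succ {b : ι} (hb : b ∈ S) (N : ℕ) (a : ι) :
    ∑ S' ∈ S.powerset, coveringWeight B S' (N + 1) a b =
      ∑ y ∈ S, (∑ S' ∈ S.powerset, coveringWeight B S' N a y) * B y b := by
  have sum_powerset : ∀ f : Finset ι → ℂ, ∑ S' ∈ S.powerset, f S' =
      ∑ S' ∈ (S.erase b).powerset, f S' + ∑ S' ∈ (S.erase b).powerset, f (insert b S') := by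
    intro f
    rw [← Finset.sum_powerset_insert (Finset.notMem_erase b S), Finset.insert_erase hb]
  have notMem : ∀ S' ∈ (S.erase b).powerset, b ∉ S' := fun S' hS' h =>
    Finset.notMem_erase b S (Finset.mem_powerset.1 hS' h)
  calc ∑ S' ∈ S.powerset, coveringWeight B S' (N + 1) a b
      = ∑ S' ∈ (S.erase b).powerset, coveringWeight B (insert b S') (N + 1) a b := by
        rw [sum_powerset, Finset.sum_eq_zero fun S' hS' =>
          coveringWeight_of_notMem_right B (notMem S' hS') _ _, zero_add]
    _ = ∑ S' ∈ (S.erase b).powerset,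
          ∑ y, (coveringWeight B (insert b S') N a y + coveringWeight B S' N a y) * B y b := by
        refine Finset.sum_congr rfl fun S' hS' => ?_
        rw [coveringWeight_succ B (Finset.mem_insert_self _ _),
          Finset.erase_insert (notMem S' hS')]
    _ = ∑ y, (∑ S' ∈ S.powerset, coveringWeight B S' N a y) * B y b := by
        rw [Finset.sum_comm]
        simp only [← Finset.sum_mul, Finset.sum_add_distrib]
        simp only [add_comm, ← sum_powerset]
    _ = ∑ y ∈ S, (∑ S' ∈ S.powerset, coveringWeight B S' N a y) * B y b := by
        refine (Finset.sum_subset (Finset.subset_univ S) fun y _ hy => ?_).symm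
        rw [Finset.sum_eq_zero fun S' hS' => coveringWeight_of_notMem_right B
          (fun h => hy (Finset.mem_powerset.1 hS' h)) _ _, zero_mul]

theorem sum_powerset_coveringWeight (S : Finset ι) (N : ℕ) (a b : S) :
    ∑ S' ∈ S.powerset, coveringWeight B S' N a b =
      ((B.submatrix (fun x : S => (x : ι)) (fun x : S => (x : ι))) ^ N) a b := by
  induction N generalizing b with
  | zero =>
    simp only [coveringWeight_zero, pow_zero, Matrix.one_apply]
    rcases eq_or_ne a b with rfl | hab
    · simp [Finset.sum_ite_eq']
    · simp [hab, Subtype.coe_injective.ne hab]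
  | succ N ih =>
    rw [sum_powerset_coveringWeight_succ B b.2, ← Finset.sum_coe_sort S, pow_succ, Matrix.mul_apply]
    refine Finset.sum_congr rfl fun y _ => ?_
    rw [ih y, Matrix.submatrix_apply]

end CoveringWeight

section DifferentialOperator

variable {ι : Type*}

theorem foldr_partialDeriv_congr [Finite ι] [DecidableEq ι] {U : Set (ι → ℝ)} (hU : IsOpen U)
    {f g : (ι → ℝ) → ℂ} (h : Set.EqOn f g U) (L : List ι) :
    Set.EqOn (L.foldr partialDeriv f) (L.foldr partialDeriv g) U := by
  have := Fintype.ofFinite ι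
  induction L with
  | nil => exact h
  | cons x L ih =>
    intro l hl
    exact (Filter.EventuallyEq.lineDeriv_eq (𝕜 := ℝ) (ih.eventuallyEq_of_mem (hU.mem_nhds hl)) :)

theorem diffOp_congr [Finite ι] [DecidableEq ι] {U : Set (ι → ℝ)} (hU : IsOpen U)
    {f g : (ι → ℝ) → ℂ} (h : Set.EqOn f g U) (q : MvPolynomial ι ℝ) :
    Set.EqOn (diffOp q f) (diffOp q g) U := by
  intro l hl
  refine Finset.sum_congr rfl fun m _ => ?_
  rw [mixedPartial, mixedPartial, foldr_partialDeriv_congr hU h _ hl]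

variable [Fintype ι]

theorem hasDerivAt_integral_mul_cexp {ψ d : (ι → ℝ) → ℂ} (hψ : Continuous ψ) (hd : Continuous d) :
    HasDerivAt (fun t : ℝ => ∫ θ, ψ θ * Complex.exp (t * d θ) ∂torusMeasure ι)
      (∫ θ, ψ θ * d θ ∂torusMeasure ι) 0 := by
  have norm_deriv_le : ∀ θ, ∀ t ∈ Metric.ball (0 : ℝ) 1,
      ‖ψ θ * (Complex.exp (t * d θ) * d θ)‖ ≤ ‖ψ θ‖ * (Real.exp ‖d θ‖ * ‖d θ‖) := by
    intro θ t ht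
    have norm_le_one : ‖t‖ ≤ 1 := (mem_ball_zero_iff.1 ht).le
    simp only [norm_mul]
    gcongr
    rw [Complex.norm_exp]
    refine Real.exp_le_exp.2 ((Complex.re_le_norm _).trans ?_)
    rw [norm_mul, Complex.norm_real]
    exact mul_le_of_le_one_left (norm_nonneg _) norm_le_one
  have hasDerivAt_mul_cexp : ∀ θ (t : ℝ), HasDerivAt (fun t : ℝ => ψ θ * Complex.exp (t * d θ))
      (ψ θ * (Complex.exp (t * d θ) * d θ)) t := by
    refine fun θ t => (HasDerivAt.cexp ?_).const_mul _
    simpa using (Complex.ofRealCLM.hasDerivAt (x := t)).mul_const (d θ)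
  simpa only [Complex.ofReal_zero, zero_mul, Complex.exp_zero, one_mul] using
    (hasDerivAt_integral_of_dominated_loc_of_deriv_le (μ := torusMeasure ι) (𝕜 := ℝ)
      (F := fun t θ => ψ θ * Complex.exp (t * d θ))
      (F' := fun t θ => ψ θ * (Complex.exp (t * d θ) * d θ)) (x₀ := 0)
      (Metric.ball_mem_nhds 0 one_pos)
      (Eventually.of_forall fun t => Continuous.aestronglyMeasurable (by fun_prop))
      (integrable_torusMeasure (by fun_prop)) (Continuous.aestronglyMeasurable (by fun_prop))
      (ae_of_all _ norm_deriv_le) (integrable_torusMeasure (by fun_prop))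
      (ae_of_all _ fun θ t _ => hasDerivAt_mul_cexp θ t)).2

/-- The torus average of `φ(θ) exp(∑ l_y D_y(θ))`. The partial derivatives in `l` act on this
family of functions of `l` by multiplying `φ` with the functions `D_y`. -/
def expAverage (D : (ι → ℝ) → ι → ℂ) (φ : (ι → ℝ) → ℂ) (l : ι → ℝ) : ℂ :=
  ∫ θ, φ θ * Complex.exp (∑ y, (l y : ℂ) * D θ y) ∂torusMeasure ι

theorem continuous_cexp_sum_mul {Y : Type*} [TopologicalSpace Y] {D : Y → ι → ℂ}
    (hD : Continuous D) (l : ι → ℝ) :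
    Continuous fun θ => Complex.exp (∑ y, (l y : ℂ) * D θ y) := by
  fun_prop

variable [DecidableEq ι] {D : (ι → ℝ) → ι → ℂ}

theorem partialDeriv_expAverage (hD : Continuous D) {φ : (ι → ℝ) → ℂ} (hφ : Continuous φ)
    (x : ι) : partialDeriv x (expAverage D φ) = expAverage D fun θ => φ θ * D θ x := by
  funext l
  have sum_add_smul_single : ∀ (t : ℝ) θ,
      ∑ y, (((l + t • (Pi.single x 1 : ι → ℝ)) y : ℝ) : ℂ) * D θ y =
        ∑ y, (l y : ℂ) * D θ y + t * D θ x := by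
    intro t θ
    simp only [Pi.add_apply, Pi.smul_apply, smul_eq_mul, Complex.ofReal_add, add_mul,
      Finset.sum_add_distrib]
    congr 1
    rw [Finset.sum_eq_single x]
    · simp
    · intro y _ hy
      simp [hy]
    · simp
  simp only [partialDeriv, lineDeriv, expAverage, sum_add_smul_single, Complex.exp_add, ← mul_assoc]
  rw [(hasDerivAt_integral_mul_cexp
    (ψ := fun θ => φ θ * Complex.exp (∑ y, (l y : ℂ) * D θ y))
    (hφ.mul (continuous_cexp_sum_mul hD l)) ((continuous_pi_iff.1 hD) x)).deriv]
  simp only [mul_right_comm]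

theorem foldr_partialDeriv_expAverage (hD : Continuous D) (L : List ι) :
    L.foldr partialDeriv (expAverage D fun _ => 1) =
      expAverage D fun θ => (L.map (D θ)).prod := by
  induction L with
  | nil => rfl
  | cons x L ih =>
    rw [List.foldr_cons, ih,
      partialDeriv_expAverage hD (continuous_list_prod L fun y _ => continuous_pi_iff.1 hD y)]
    simp only [List.map_cons, List.prod_cons, mul_comm]

theorem mixedPartial_expAverage (hD : Continuous D) (m : ι →₀ ℕ) :
    mixedPartial m (expAverage D fun _ => 1) =
      expAverage D fun θ => ∏ x ∈ m.support, D θ x ^ m x := by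
  rw [mixedPartial, foldr_partialDeriv_expAverage hD]
  congr 1
  funext θ
  rw [← Multiset.prod_coe, ← Multiset.map_coe, Multiset.coe_toList, Finsupp.toMultiset_map,
    Finsupp.prod_toMultiset, Finsupp.prod_mapDomain_index pow_zero pow_add, Finsupp.prod]

theorem diffOp_expAverage (hD : Continuous D) (q : MvPolynomial ι ℝ) :
    diffOp q (expAverage D fun _ => 1) = expAverage D fun θ => MvPolynomial.aeval (D θ) q := by
  funext l
  simp only [diffOp, mixedPartial_expAverage hD, expAverage, MvPolynomial.aeval_def,
    MvPolynomial.eval₂_eq, Finset.sum_mul]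
  rw [integral_finsetSum]
  · refine Finset.sum_congr rfl fun m _ => ?_
    rw [← integral_const_mul]
    simp only [Complex.coe_algebraMap, mul_assoc]
  · intro m _
    exact integrable_torusMeasure ((continuous_const.mul (continuous_finsetProd _ fun x _ =>
      ((continuous_apply x).comp hD).pow _)).mul (continuous_cexp_sum_mul hD l))

end DifferentialOperator

section EntireDensity

variable {ι : Type*} [Fintype ι]

/-- The angular integral is a Laurent average over the torus of radii `√l_x`, whose contours can be
shifted to radius `1`. -/
theorem angularIntegral_eq_expAverage (A : Matrix ι ι ℝ) {l : ι → ℝ} (hl : ∀ x, 0 < l x) :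
    angularIntegral A l =
      expAverage (fun θ => columnRatio (A.map Complex.ofReal) Finset.univ (polarPoint 1 θ))
        (fun _ => 1) l := by
  have sqrt_pos : ∀ x, 0 < √(l x) := fun x => Real.sqrt_pos.2 (hl x)
  have differentiable_cexp : Differentiable ℂ fun D : ι → ℂ =>
      Complex.exp (∑ y, (l y : ℂ) * D y) := by fun_prop
  simp only [expAverage, one_mul]
  rw [← integral_polarPoint_eq (r := fun x => √(l x)) (f := fun w =>
      Complex.exp (∑ y, (l y : ℂ) * columnRatio (A.map Complex.ofReal) Finset.univ w y))
      (fun w hw => (differentiable_cexp _).comp w (differentiableAt_columnRatio _ _ hw)) sqrt_pos,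
    angularIntegral, integral_torusMeasure]
  congr 1
  refine integral_congr_ae (ae_of_all _ fun θ => ?_)
  simp only
  rw [Finset.sum_comm]
  congr 1
  refine Finset.sum_congr rfl fun y _ => ?_
  rw [columnRatio, Finset.mul_sum]
  refine Finset.sum_congr rfl fun x _ => ?_
  have sqrt_ne_zero : (√(l y) : ℂ) ≠ 0 := Complex.ofReal_ne_zero.2 (sqrt_pos y).ne'
  have sqrt_mul_sqrt : (l y : ℂ) = √(l y) * √(l y) := by
    exact_mod_cast (Real.mul_self_sqrt (hl y).le).symm
  rw [sqrt_mul_sqrt, mul_sub, Complex.exp_sub, Matrix.map_apply, polarPoint_apply, polarPoint_apply,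
    mul_comm Complex.I, mul_comm Complex.I]
  field_simp

variable [DecidableEq ι]

/-- The torus average of `adj(diag D - B)_{ab} exp(∑ l_y D_y)`, where `D` is the column ratio of
`B`. It agrees with the density on the positive orthant and is an entire function of `l`. -/
def entireDensity (B : Matrix ι ι ℂ) (a b : ι) : (ι → ℝ) → ℂ :=
  expAverage (fun θ => columnRatio B Finset.univ (polarPoint 1 θ)) fun θ =>
    (Matrix.diagonal (columnRatio B Finset.univ (polarPoint 1 θ)) - B).adjugate a b

theorem aeval_cofactor_symbolMatrix (A : Matrix ι ι ℝ) (a b : ι) (D : ι → ℂ) :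
    MvPolynomial.aeval D (cofactor a b (symbolMatrix (-A))) =
      (Matrix.diagonal D - A.map Complex.ofReal).adjugate a b := by
  have mapMatrix_symbolMatrix : (MvPolynomial.aeval D).mapMatrix (symbolMatrix (-A)) =
      Matrix.diagonal D - A.map Complex.ofReal := by
    ext x y
    rcases eq_or_ne x y with rfl | hxy
    · simp only [symbolMatrix, AlgHom.mapMatrix_apply, Matrix.map_apply, Matrix.add_apply,
        Matrix.diagonal_apply_eq, Matrix.neg_apply, map_neg, map_add, MvPolynomial.algHom_C,
        MvPolynomial.aeval_X, Complex.coe_algebraMap, Matrix.sub_apply, neg_add_eq_sub]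
    · simp [symbolMatrix, hxy]
  rw [cofactor_eq_adjugate, ← mapMatrix_symbolMatrix, ← AlgHom.map_adjugate,
    AlgHom.mapMatrix_apply, Matrix.map_apply]

theorem density_eq_entireDensity (A : Matrix ι ι ℝ) (a b : ι) {l : ι → ℝ} (hl : ∀ x, 0 < l x) :
    density A a b l = entireDensity (A.map Complex.ofReal) a b l := by
  have isOpen_orthant : IsOpen {l : ι → ℝ | ∀ x, 0 < l x} := by
    simp only [Set.ofPred_forall]
    exact isOpen_iInter_of_finite fun x => isOpen_lt continuous_const (continuous_apply x)
  rw [density,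
    diffOp_congr isOpen_orthant (fun l hl => angularIntegral_eq_expAverage A hl) _ hl,
    diffOp_expAverage (continuous_columnRatio_polarPoint _ _)]
  simp only [aeval_cofactor_symbolMatrix, entireDensity]

theorem continuous_adjugate_columnRatio (B : Matrix ι ι ℂ) (a b : ι) :
    Continuous fun θ : ι → ℝ =>
      (Matrix.diagonal (columnRatio B Finset.univ (polarPoint 1 θ)) - B).adjugate a b := by
  simp only [← maskedMatrix_univ]
  exact (differentiable_adjugate_maskedMatrix B Finset.univ a b).continuous.comp
    (continuous_columnRatio_polarPoint B Finset.univ)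

theorem columnRatio_add_diagonal (B : Matrix ι ι ℂ) (v : ι → ℂ) {w : ι → ℂ} (hw : ∀ x, w x ≠ 0) :
    columnRatio (B + Matrix.diagonal v) Finset.univ w = columnRatio B Finset.univ w + v := by
  funext y
  simp only [columnRatio, Matrix.add_apply, mul_add, add_mul, Finset.sum_add_distrib, Pi.add_apply]
  congr 1
  rw [Finset.sum_eq_single y]
  · rw [Matrix.diagonal_apply_eq, mul_comm (w y), mul_inv_cancel_right₀ (hw y)]
  · intro x _ hx
    rw [Matrix.diagonal_apply_ne _ hx, mul_zero, zero_mul]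
  · exact fun hy => absurd (Finset.mem_univ y) hy

theorem entireDensity_add_diagonal (B : Matrix ι ι ℂ) (v : ι → ℂ) (a b : ι) (l : ι → ℝ) :
    entireDensity (B + Matrix.diagonal v) a b l =
      Complex.exp (∑ y, (l y : ℂ) * v y) * entireDensity B a b l := by
  have diagonal_add_sub : ∀ D : ι → ℂ, Matrix.diagonal (D + v) - (B + Matrix.diagonal v) =
      Matrix.diagonal D - B := fun D => by
    rw [← add_sub_add_right_eq_sub (Matrix.diagonal D) B (Matrix.diagonal v), Matrix.diagonal_add]
    rfl
  simp only [entireDensity, expAverage,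
    columnRatio_add_diagonal B v (polarPoint_one_apply_ne_zero _), diagonal_add_sub]
  rw [← integral_const_mul]
  refine integral_congr_ae (ae_of_all _ fun θ => ?_)
  simp only [Pi.add_apply, mul_add, Finset.sum_add_distrib, Complex.exp_add]
  ring

end EntireDensity

section ExponentialSeries

variable {α : Type*} [MeasurableSpace α] {μ : Measure α} {φ Z : α → ℂ}

theorem integrable_mul_cexp_of_integrable_norm (hφ : AEStronglyMeasurable φ μ)
    (hZ : AEStronglyMeasurable Z μ) (h : Integrable (fun q => ‖φ q‖ * Real.exp ‖Z q‖) μ) :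
    Integrable (fun q => φ q * Complex.exp (Z q)) μ := by
  refine h.mono' (hφ.mul (Complex.continuous_exp.comp_aestronglyMeasurable hZ))
    (ae_of_all _ fun q => ?_)
  rw [norm_mul, Complex.norm_exp]
  gcongr
  exact Complex.re_le_norm _

theorem aestronglyMeasurable_mul_pow_div_factorial (hφ : AEStronglyMeasurable φ μ)
    (hZ : AEStronglyMeasurable Z μ) (n : ℕ) :
    AEStronglyMeasurable (fun q => φ q * (Z q ^ n / n.factorial)) μ :=
  (hφ.mul ((hZ.pow n).mul_const (n.factorial : ℂ)⁻¹) :)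

theorem integrable_mul_pow_div_factorial_of_integrable_norm (hφ : AEStronglyMeasurable φ μ)
    (hZ : AEStronglyMeasurable Z μ) (h : Integrable (fun q => ‖φ q‖ * Real.exp ‖Z q‖) μ) (n : ℕ) :
    Integrable (fun q => φ q * (Z q ^ n / n.factorial)) μ := by
  refine h.mono' (aestronglyMeasurable_mul_pow_div_factorial hφ hZ n) (ae_of_all _ fun q => ?_)
  rw [norm_mul, norm_div, norm_pow, Complex.norm_natCast]
  gcongr
  exact Real.pow_div_factorial_le_exp _ (norm_nonneg _) n

theorem hasSum_integral_mul_cexp (hφ : AEStronglyMeasurable φ μ) (hZ : AEStronglyMeasurable Z μ)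
    (h : Integrable (fun q => ‖φ q‖ * Real.exp ‖Z q‖) μ) :
    HasSum (fun n : ℕ => ∫ q, φ q * (Z q ^ n / n.factorial) ∂μ)
      (∫ q, φ q * Complex.exp (Z q) ∂μ) := by
  have hasSum_norm : ∀ q, HasSum (fun n : ℕ => ‖φ q‖ * (‖Z q‖ ^ n / n.factorial))
      (‖φ q‖ * Real.exp ‖Z q‖) := fun q => by
    rw [Real.exp_eq_exp_ℝ]
    exact (NormedSpace.expSeries_div_hasSum_exp ‖Z q‖).mul_left _
  have hasSum_cexp : ∀ q, HasSum (fun n : ℕ => φ q * (Z q ^ n / n.factorial))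
      (φ q * Complex.exp (Z q)) := fun q => by
    rw [Complex.exp_eq_exp_ℂ]
    exact (NormedSpace.expSeries_div_hasSum_exp (Z q)).mul_left _
  refine hasSum_integral_of_dominated_convergence
    (fun (n : ℕ) q => ‖φ q‖ * (‖Z q‖ ^ n / n.factorial))
    (aestronglyMeasurable_mul_pow_div_factorial hφ hZ) (fun n => ae_of_all _ fun q => ?_)
    (ae_of_all _ fun q => (hasSum_norm q).summable)
    (by simpa only [(hasSum_norm _).tsum_eq] using h) (ae_of_all _ hasSum_cexp)
  rw [norm_mul, norm_div, norm_pow, Complex.norm_natCast]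

end ExponentialSeries

section GammaIntegral

theorem integrableOn_exp_neg_mul_pow (n : ℕ) :
    IntegrableOn (fun t : ℝ => Real.exp (-t) * t ^ n) (Set.Ioi 0) := by
  simpa only [add_sub_cancel_right, Real.rpow_natCast] using
    Real.GammaIntegral_convergent (s := n + 1) (by positivity)

theorem integral_exp_neg_mul_pow (n : ℕ) :
    ∫ t in Set.Ioi (0 : ℝ), Real.exp (-t) * t ^ n = n.factorial := by
  rw [← Real.Gamma_nat_eq_factorial, Real.Gamma_eq_integral (by positivity)]
  simp only [add_sub_cancel_right, Real.rpow_natCast]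

theorem lintegral_exp_neg_mul_pow (n : ℕ) :
    ∫⁻ t in Set.Ioi (0 : ℝ), ENNReal.ofReal (Real.exp (-t) * t ^ n) = n.factorial := by
  rw [← ofReal_integral_eq_lintegral_ofReal (integrableOn_exp_neg_mul_pow n),
    integral_exp_neg_mul_pow, ENNReal.ofReal_natCast]
  filter_upwards [ae_restrict_mem measurableSet_Ioi] with t (ht : 0 < t)
  positivity

end GammaIntegral

section Simplex

variable {ι : Type*} [Fintype ι]

theorem measurableSet_openSimplex (T : ℝ) : MeasurableSet (openSimplex ι T) := by
  have measurableSet_orthant : MeasurableSet {l : ι → ℝ | ∀ x, 0 < l x} := by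
    simp only [Set.ofPred_forall]
    exact MeasurableSet.iInter fun x => measurableSet_lt measurable_const (measurable_pi_apply x)
  exact measurableSet_orthant.inter (measurableSet_eq_fun (by fun_prop) measurable_const)

theorem mem_Icc_of_mem_openSimplex {T : ℝ} {l : ι → ℝ} (hl : l ∈ openSimplex ι T) (x : ι) :
    l x ∈ Set.Icc 0 T := by
  refine ⟨(hl.1 x).le, ?_⟩
  rw [← hl.2]
  exact Finset.single_le_sum (fun y _ => (hl.1 y).le) (Finset.mem_univ x)

theorem smul_mem_openSimplex_iff {T : ℝ} (hT : 0 < T) {l : ι → ℝ} :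
    T • l ∈ openSimplex ι T ↔ l ∈ openSimplex ι 1 := by
  simp only [openSimplex, Set.mem_ofPred_eq, Pi.smul_apply, smul_eq_mul, ← Finset.mul_sum,
    mul_pos_iff_of_pos_left hT, mul_eq_left₀ hT.ne']

theorem norm_sum_mul_le {T : ℝ} {l : ι → ℝ} (hl : l ∈ openSimplex ι T) (D : ι → ℂ) :
    ‖∑ y, (l y : ℂ) * D y‖ ≤ T * ∑ y, ‖D y‖ := by
  refine (norm_sum_le _ _).trans ?_
  rw [Finset.mul_sum]
  refine Finset.sum_le_sum fun y _ => ?_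
  have hly := mem_Icc_of_mem_openSimplex hl y
  rw [norm_mul, Complex.norm_real, Real.norm_of_nonneg hly.1]
  exact mul_le_mul_of_nonneg_right hly.2 (norm_nonneg _)

/-- The normalized monomial `∏_x l_x ^ {k_x} / k_x!`: the density of the total holding times if
the state `x` is visited `k_x + 1` times and the holding rates are `1`, up to an exponential. -/
def dividedMonomial (k : ι → ℕ) (l : ι → ℝ) : ℝ := ∏ x, l x ^ k x / (k x).factorial

theorem continuous_dividedMonomial (k : ι → ℕ) : Continuous (dividedMonomial k) := by
  unfold dividedMonomial
  fun_prop

theorem dividedMonomial_nonneg (k : ι → ℕ) {l : ι → ℝ} (hl : ∀ x, 0 ≤ l x) :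
    0 ≤ dividedMonomial k l :=
  Finset.prod_nonneg fun x _ => div_nonneg (pow_nonneg (hl x) _) (Nat.cast_nonneg _)

theorem dividedMonomial_smul (k : ι → ℕ) (T : ℝ) (l : ι → ℝ) :
    dividedMonomial k (T • l) = T ^ (∑ x, k x) * dividedMonomial k l := by
  rw [dividedMonomial, dividedMonomial, ← Finset.prod_pow_eq_pow_sum, ← Finset.prod_mul_distrib]
  simp only [Pi.smul_apply, smul_eq_mul, mul_pow, mul_div_assoc]

theorem sum_mul_pow_div_factorial [DecidableEq ι] (l : ι → ℝ) (D : ι → ℂ) (n : ℕ) :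
    (∑ y, (l y : ℂ) * D y) ^ n / n.factorial =
      ∑ k ∈ Finset.univ.piAntidiag n, (∏ x, D x ^ k x) * (dividedMonomial k l : ℂ) := by
  rw [Finset.sum_pow_eq_sum_piAntidiag, Finset.sum_div]
  refine Finset.sum_congr rfl fun k hk => ?_
  have prod_factorial_mul_multinomial :
      (∏ x, ((k x).factorial : ℂ)) * Nat.multinomial Finset.univ k = n.factorial := by
    have spec := Nat.multinomial_spec Finset.univ k
    rw [(Finset.mem_piAntidiag.1 hk).1] at spec
    exact_mod_cast spec
  have prod_factorial_ne_zero : (∏ x, ((k x).factorial : ℂ)) ≠ 0 :=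
    Finset.prod_ne_zero_iff.2 fun x _ => Nat.cast_ne_zero.2 (Nat.factorial_ne_zero _)
  have factorial_ne_zero : (n.factorial : ℂ) ≠ 0 := Nat.cast_ne_zero.2 (Nat.factorial_ne_zero _)
  simp only [dividedMonomial, Complex.ofReal_prod, Complex.ofReal_div, Complex.ofReal_pow,
    Complex.ofReal_natCast, mul_pow, Finset.prod_mul_distrib, Finset.prod_div_distrib]
  field_simp
  rw [← prod_factorial_mul_multinomial]
  ring

theorem lintegral_orthant_exp_neg_mul_dividedMonomial (k : ι → ℕ) :
    ∫⁻ l in {l : ι → ℝ | ∀ x, 0 < l x},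
      ENNReal.ofReal (Real.exp (-∑ x, l x) * dividedMonomial k l) = 1 := by
  have orthant_eq_pi : {l : ι → ℝ | ∀ x, 0 < l x} = Set.univ.pi fun _ => Set.Ioi 0 := by
    ext l
    simp
  have exp_mul_eq_prod : ∀ l : ι → ℝ, Real.exp (-∑ x, l x) * dividedMonomial k l =
      ∏ x, (Real.exp (-l x) * l x ^ k x / (k x).factorial) := by
    intro l
    rw [← Finset.sum_neg_distrib, Real.exp_sum, dividedMonomial, ← Finset.prod_mul_distrib]
    simp only [mul_div_assoc]
  have integrable_prod : Integrable
      (fun l : ι → ℝ => ∏ x, (Real.exp (-l x) * l x ^ k x / (k x).factorial))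
      (Measure.pi fun _ : ι => (volume : Measure ℝ).restrict (Set.Ioi 0)) :=
    Integrable.fintype_prod (f := fun x (t : ℝ) => Real.exp (-t) * t ^ k x / (k x).factorial)
      fun x => (integrableOn_exp_neg_mul_pow (k x)).div_const _
  have integral_factor_eq_one : ∀ x,
      ∫ t in Set.Ioi (0 : ℝ), Real.exp (-t) * t ^ k x / (k x).factorial = 1 := by
    intro x
    rw [integral_div, integral_exp_neg_mul_pow,
      div_self (Nat.cast_ne_zero.2 (Nat.factorial_ne_zero _))]
  simp only [exp_mul_eq_prod]
  rw [orthant_eq_pi, volume_pi, Measure.restrict_pi_pi,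
    ← ofReal_integral_eq_lintegral_ofReal integrable_prod,
    integral_fintype_prod_eq_prod (f := fun x (t : ℝ) => Real.exp (-t) * t ^ k x / (k x).factorial)]
  · simp only [integral_factor_eq_one, Finset.prod_const_one, ENNReal.ofReal_one]
  · rw [← Measure.restrict_pi_pi]
    filter_upwards [ae_restrict_mem (MeasurableSet.univ_pi fun _ => measurableSet_Ioi)] with l hl
    refine Finset.prod_nonneg fun x _ => ?_
    have l_pos : 0 < l x := hl x (Set.mem_univ x)
    positivity

variable [DecidableEq ι]

theorem ae_simplexMeasure_mem (c : ι) (T : ℝ) : ∀ᵐ l ∂simplexMeasure c T, l ∈ openSimplex ι T :=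
  ae_restrict_mem (measurableSet_openSimplex T)

theorem lintegral_simplexMeasure_eq (c : ι) (T : ℝ) {F : (ι → ℝ) → ℝ≥0∞} (hF : Measurable F) :
    ∫⁻ l, F l ∂simplexMeasure c T =
      ∫⁻ u, (openSimplex ι T).indicator F (hyperplanePoint c T u) := by
  rw [simplexMeasure, ← lintegral_indicator (measurableSet_openSimplex T),
    lintegral_map (hF.indicator (measurableSet_openSimplex T)) (measurable_hyperplanePoint c T)]

theorem hyperplanePoint_smul (c : ι) (T : ℝ) (u : {x : ι // x ≠ c} → ℝ) :
    hyperplanePoint c T (T • u) = T • hyperplanePoint c 1 u := by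
  funext x
  by_cases h : x = c
  · simp [hyperplanePoint, h, mul_sub, Finset.mul_sum]
  · simp [hyperplanePoint, h]

theorem lintegral_simplexMeasure_scale (c : ι) {T : ℝ} (hT : 0 < T) {F : (ι → ℝ) → ℝ≥0∞}
    (hF : Measurable F) :
    ∫⁻ l, F l ∂simplexMeasure c T =
      ENNReal.ofReal (T ^ Fintype.card {x : ι // x ≠ c}) *
        ∫⁻ l, F (T • l) ∂simplexMeasure c 1 := by
  have measurable_indicator :
      Measurable fun u => (openSimplex ι T).indicator F (hyperplanePoint c T u) :=
    (hF.indicator (measurableSet_openSimplex T)).comp (measurable_hyperplanePoint c T)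
  have indicator_smul : ∀ u : {x : ι // x ≠ c} → ℝ,
      (openSimplex ι 1).indicator (fun l => F (T • l)) (hyperplanePoint c 1 u) =
        (openSimplex ι T).indicator F (hyperplanePoint c T (T • u)) := by
    intro u
    rw [hyperplanePoint_smul]
    by_cases h : hyperplanePoint c 1 u ∈ openSimplex ι 1
    · rw [Set.indicator_of_mem h, Set.indicator_of_mem ((smul_mem_openSimplex_iff hT).2 h)]
    · rw [Set.indicator_of_notMem h,
        Set.indicator_of_notMem (mt (smul_mem_openSimplex_iff hT).1 h)]
  rw [lintegral_simplexMeasure_eq c T hF,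
    lintegral_simplexMeasure_eq c 1 (F := fun l => F (T • l)) (hF.comp (measurable_const_smul T))]
  simp only [indicator_smul]
  rw [← lintegral_map measurable_indicator (measurable_const_smul T),
    Measure.map_addHaar_smul _ hT.ne', lintegral_smul_measure, smul_eq_mul, ← mul_assoc,
    Module.finrank_pi, ← ENNReal.ofReal_mul (by positivity), abs_of_nonneg (by positivity),
    mul_inv_cancel₀ (by positivity), ENNReal.ofReal_one, one_mul]

theorem lintegral_dividedMonomial_simplexMeasure_scale (c : ι) {T : ℝ} (hT : 0 < T) (k : ι → ℕ) :
    ∫⁻ l, ENNReal.ofReal (dividedMonomial k l) ∂simplexMeasure c T =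
      ENNReal.ofReal (T ^ (∑ x, k x + Fintype.card {x : ι // x ≠ c})) *
        ∫⁻ l, ENNReal.ofReal (dividedMonomial k l) ∂simplexMeasure c 1 := by
  have measurable_dividedMonomial : Measurable fun l => ENNReal.ofReal (dividedMonomial k l) :=
    (continuous_dividedMonomial k).measurable.ennreal_ofReal
  rw [lintegral_simplexMeasure_scale c hT measurable_dividedMonomial]
  simp only [dividedMonomial_smul, ENNReal.ofReal_mul (pow_nonneg hT.le (∑ x, k x))]
  rw [lintegral_const_mul _ measurable_dividedMonomial, ← mul_assoc,
    ← ENNReal.ofReal_mul (by positivity), pow_add, mul_comm (T ^ Fintype.card _)]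

/-- The Dirichlet integral. By homogeneity it is a multiple of a power of `T`, and the constant is
found by integrating against `exp (-T)`, which turns the left-hand side into a product of Gamma
integrals. -/
theorem lintegral_dividedMonomial_simplexMeasure (c : ι) {T : ℝ} (hT : 0 < T) (k : ι → ℕ) :
    ∫⁻ l, ENNReal.ofReal (dividedMonomial k l) ∂simplexMeasure c T =
      ENNReal.ofReal (T ^ (∑ x, k x + Fintype.card {x : ι // x ≠ c}) /
        (∑ x, k x + Fintype.card {x : ι // x ≠ c}).factorial) := by
  set d := Fintype.card {x : ι // x ≠ c}
  have lintegral_exp_neg_mul : ∀ s ∈ Set.Ioi (0 : ℝ),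
      ∫⁻ l, ENNReal.ofReal (Real.exp (-∑ x, l x) * dividedMonomial k l) ∂simplexMeasure c s =
        ENNReal.ofReal (Real.exp (-s) * s ^ (∑ x, k x + d)) *
          ∫⁻ l, ENNReal.ofReal (dividedMonomial k l) ∂simplexMeasure c 1 := by
    intro s (hs : 0 < s)
    rw [ENNReal.ofReal_mul (by positivity), mul_assoc,
      ← lintegral_dividedMonomial_simplexMeasure_scale c hs,
      ← lintegral_const_mul _ (continuous_dividedMonomial k).measurable.ennreal_ofReal]
    refine lintegral_congr_ae ?_
    filter_upwards [ae_simplexMeasure_mem c s] with l hl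
    rw [hl.2, ENNReal.ofReal_mul (by positivity)]
  have continuous_exp_neg_mul :
      Continuous fun l : ι → ℝ => Real.exp (-∑ x, l x) * dividedMonomial k l :=
    Continuous.mul (by fun_prop) (continuous_dividedMonomial k)
  have factorial_mul_eq_one : ((∑ x, k x + d).factorial : ℝ≥0∞) *
      ∫⁻ l, ENNReal.ofReal (dividedMonomial k l) ∂simplexMeasure c 1 = 1 := by
    rw [← lintegral_exp_neg_mul_pow, ← lintegral_mul_const _ (by fun_prop),
      ← setLIntegral_congr_fun measurableSet_Ioi lintegral_exp_neg_mul,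
      ← lintegral_simplexMeasure c _ continuous_exp_neg_mul.measurable.ennreal_ofReal,
      lintegral_orthant_exp_neg_mul_dividedMonomial]
  rw [lintegral_dividedMonomial_simplexMeasure_scale c hT,
    ENNReal.eq_inv_of_mul_eq_one_left ((mul_comm _ _).trans factorial_mul_eq_one),
    ENNReal.ofReal_div_of_pos (by positivity), ENNReal.ofReal_natCast, div_eq_mul_inv]

instance (c : ι) (T : ℝ) : IsFiniteMeasure (simplexMeasure c T) := by
  by_cases hT : 0 < T
  · constructor
    have mass := lintegral_dividedMonomial_simplexMeasure c hT 0
    simp only [dividedMonomial, Pi.zero_apply, pow_zero, Nat.factorial_zero, Nat.cast_one, div_one,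
      Finset.prod_const_one, ENNReal.ofReal_one, lintegral_one] at mass
    rw [mass]
    exact ENNReal.ofReal_lt_top
  · have openSimplex_eq_empty : openSimplex ι T = ∅ := by
      refine Set.eq_empty_of_forall_notMem fun l hl => hT ?_
      exact (hl.1 c).trans_le (mem_Icc_of_mem_openSimplex hl c).2
    rw [simplexMeasure, openSimplex_eq_empty, Measure.restrict_empty]
    infer_instance

theorem integral_dividedMonomial_simplexMeasure (c : ι) {T : ℝ} (hT : 0 < T) (k : ι → ℕ) :
    ∫ l, dividedMonomial k l ∂simplexMeasure c T =
      T ^ (∑ x, k x + Fintype.card {x : ι // x ≠ c}) /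
        (∑ x, k x + Fintype.card {x : ι // x ≠ c}).factorial := by
  rw [integral_eq_lintegral_of_nonneg_ae, lintegral_dividedMonomial_simplexMeasure c hT,
    ENNReal.toReal_ofReal (by positivity)]
  · filter_upwards [ae_simplexMeasure_mem c T] with l hl
    exact dividedMonomial_nonneg k fun x => (hl.1 x).le
  · exact (continuous_dividedMonomial k).aestronglyMeasurable

theorem integrable_simplexMeasure_of_continuous {E : Type*} [NormedAddCommGroup E]
    {f : (ι → ℝ) → E} (hf : Continuous f) (c : ι) (T : ℝ) : Integrable f (simplexMeasure c T) := by
  have isCompact_box : IsCompact (Set.univ.pi fun _ : ι => Set.Icc (0 : ℝ) T) :=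
    isCompact_univ_pi fun _ => isCompact_Icc
  obtain ⟨C, hC⟩ := isCompact_box.exists_bound_of_continuousOn hf.continuousOn
  refine Integrable.of_bound hf.aestronglyMeasurable C ?_
  filter_upwards [ae_simplexMeasure_mem c T] with l hl
  exact hC l fun x _ => mem_Icc_of_mem_openSimplex hl x

theorem integral_pow_simplexMeasure (c : ι) {T : ℝ} (hT : 0 < T) (D : ι → ℂ) (n : ℕ) :
    ∫ l, (∑ y, (l y : ℂ) * D y) ^ n / n.factorial ∂simplexMeasure c T =
      completeHomogeneous Finset.univ n D * ((T : ℂ) ^ (n + Fintype.card {x : ι // x ≠ c}) /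
        (n + Fintype.card {x : ι // x ≠ c}).factorial) := by
  simp only [sum_mul_pow_div_factorial]
  rw [integral_finsetSum]
  · rw [completeHomogeneous, Finset.sum_mul]
    refine Finset.sum_congr rfl fun k hk => ?_
    rw [integral_const_mul, integral_complex_ofReal, integral_dividedMonomial_simplexMeasure c hT,
      (Finset.mem_piAntidiag.1 hk).1]
    push_cast
    rfl
  · intro k _
    exact (integrable_simplexMeasure_of_continuous
      (continuous_dividedMonomial k) c T).ofReal.const_mul _

end Simplex

section SimplexAverage

variable {ι : Type*} [Fintype ι] [DecidableEq ι] {D : (ι → ℝ) → ι → ℂ} {φ : (ι → ℝ) → ℂ}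

theorem integrable_norm_mul_exp_norm_sum_mul (hD : Continuous D) (hφ : Continuous φ) (c : ι)
    (T : ℝ) :
    Integrable (fun q : (ι → ℝ) × (ι → ℝ) =>
      ‖φ q.2‖ * Real.exp ‖∑ y, (q.1 y : ℂ) * D q.2 y‖)
        ((simplexMeasure c T).prod (torusMeasure ι)) := by
  have integrable_bound : Integrable (fun q : (ι → ℝ) × (ι → ℝ) =>
      ‖φ q.2‖ * Real.exp (T * ∑ y, ‖D q.2 y‖)) ((simplexMeasure c T).prod (torusMeasure ι)) :=
    (integrable_torusMeasure
      (by fun_prop : Continuous fun θ => ‖φ θ‖ * Real.exp (T * ∑ y, ‖D θ y‖))).comp_snd _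
  refine integrable_bound.mono' (Continuous.aestronglyMeasurable (by fun_prop)) ?_
  filter_upwards [Measure.quasiMeasurePreserving_fst.ae (ae_simplexMeasure_mem c T)] with q hq
  rw [Real.norm_of_nonneg (by positivity)]
  gcongr
  exact norm_sum_mul_le hq _

theorem integrable_expAverage (hD : Continuous D) (hφ : Continuous φ) (c : ι) (T : ℝ) :
    Integrable (expAverage D φ) (simplexMeasure c T) :=
  (integrable_mul_cexp_of_integrable_norm
    (Continuous.aestronglyMeasurable (by fun_prop)) (Continuous.aestronglyMeasurable (by fun_prop))
    (integrable_norm_mul_exp_norm_sum_mul hD hφ c T)).integral_prod_left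

theorem hasSum_integral_expAverage (hD : Continuous D) (hφ : Continuous φ) (c : ι) {T : ℝ}
    (hT : 0 < T) :
    HasSum (fun n : ℕ => (T : ℂ) ^ (n + Fintype.card {x : ι // x ≠ c}) /
        (n + Fintype.card {x : ι // x ≠ c}).factorial *
          ∫ θ, φ θ * completeHomogeneous Finset.univ n (D θ) ∂torusMeasure ι)
      (∫ l, expAverage D φ l ∂simplexMeasure c T) := by
  have aestronglyMeasurable_weight : AEStronglyMeasurable
      (fun q : (ι → ℝ) × (ι → ℝ) => φ q.2) ((simplexMeasure c T).prod (torusMeasure ι)) :=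
    Continuous.aestronglyMeasurable (by fun_prop)
  have aestronglyMeasurable_exponent : AEStronglyMeasurable
      (fun q : (ι → ℝ) × (ι → ℝ) => ∑ y, (q.1 y : ℂ) * D q.2 y)
      ((simplexMeasure c T).prod (torusMeasure ι)) :=
    Continuous.aestronglyMeasurable (by fun_prop)
  have integrable_norm := integrable_norm_mul_exp_norm_sum_mul hD hφ c T
  have hasSum_prod := hasSum_integral_mul_cexp aestronglyMeasurable_weight
    aestronglyMeasurable_exponent integrable_norm
  rw [integral_prod _ (integrable_mul_cexp_of_integrable_norm aestronglyMeasurable_weight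
    aestronglyMeasurable_exponent integrable_norm)] at hasSum_prod
  convert! hasSum_prod using 2 with n
  rw [integral_prod_symm _ (integrable_mul_pow_div_factorial_of_integrable_norm
    aestronglyMeasurable_weight aestronglyMeasurable_exponent integrable_norm n)]
  simp only [integral_const_mul, integral_pow_simplexMeasure c hT, ← mul_assoc]
  rw [integral_mul_const, mul_comm]

theorem card_univ_eq_card_ne_add_one (c : ι) :
    (Finset.univ : Finset ι).card = Fintype.card {x : ι // x ≠ c} + 1 := by
  have card_pos : 0 < Fintype.card ι := Fintype.card_pos_iff.2 ⟨c⟩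
  rw [Finset.card_univ, Fintype.card_subtype_compl, Fintype.card_subtype_eq]
  lia

theorem coveringWeight_univ_add (B : Matrix ι ι ℂ) (a b c : ι) (n : ℕ) :
    coveringWeight B Finset.univ (n + Fintype.card {x : ι // x ≠ c}) a b =
      ∫ θ, (Matrix.diagonal (columnRatio B Finset.univ (polarPoint 1 θ)) - B).adjugate a b *
        completeHomogeneous Finset.univ n (columnRatio B Finset.univ (polarPoint 1 θ))
          ∂torusMeasure ι := by
  simp only [coveringWeight_of_mem B (Finset.mem_univ a) (Finset.mem_univ b), maskedMatrix_univ,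
    holdingWeight, card_univ_eq_card_ne_add_one c, Nat.add_sub_add_right, Nat.add_sub_cancel,
    add_le_add_iff_right, Nat.le_add_left, if_true]

theorem coveringWeight_univ_of_lt (B : Matrix ι ι ℂ) (a b c : ι) {N : ℕ}
    (hN : N < Fintype.card {x : ι // x ≠ c}) : coveringWeight B Finset.univ N a b = 0 := by
  simp only [coveringWeight_of_mem B (Finset.mem_univ a) (Finset.mem_univ b), holdingWeight,
    card_univ_eq_card_ne_add_one c, add_le_add_iff_right, if_neg hN.not_ge, mul_zero,
    integral_zero]

theorem integrable_entireDensity (B : Matrix ι ι ℂ) (a b c : ι) (T : ℝ) :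
    Integrable (entireDensity B a b) (simplexMeasure c T) :=
  integrable_expAverage (continuous_columnRatio_polarPoint B _)
    (continuous_adjugate_columnRatio B a b) c T

theorem hasSum_integral_entireDensity (B : Matrix ι ι ℂ) (a b c : ι) {T : ℝ} (hT : 0 < T) :
    HasSum (fun N : ℕ => (T : ℂ) ^ N / N.factorial * coveringWeight B Finset.univ N a b)
      (∫ l, entireDensity B a b l ∂simplexMeasure c T) := by
  have hasSum_shifted := hasSum_integral_expAverage
    (continuous_columnRatio_polarPoint B Finset.univ)
    (continuous_adjugate_columnRatio B a b) c hT
  simp only [← coveringWeight_univ_add B a b c] at hasSum_shifted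
  refine ((add_left_injective (Fintype.card {x : ι // x ≠ c})).hasSum_iff fun N hN => ?_).1
    hasSum_shifted
  rw [coveringWeight_univ_of_lt B a b c, mul_zero]
  by_contra! h
  exact hN ⟨N - _, Nat.sub_add_cancel h⟩

end SimplexAverage

section PowerLimit

variable {𝔸 : Type*} [NormedRing 𝔸]

theorem norm_pow_sub_pow_le [NormOneClass 𝔸] {x z : 𝔸} {M : ℝ} (hM : 1 ≤ M) (hx : ‖x‖ ≤ M)
    (hz : ‖z‖ ≤ M) (n : ℕ) : ‖x ^ n - z ^ n‖ ≤ n * M ^ n * ‖x - z‖ := by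
  induction n with
  | zero => simp
  | succ n ih =>
    have : 0 ≤ M := zero_le_one.trans hM
    have telescope : x ^ (n + 1) - z ^ (n + 1) = x ^ n * (x - z) + (x ^ n - z ^ n) * z := by
      simp only [pow_succ]
      noncomm_ring
    have norm_pow_le_succ : ‖x ^ n‖ ≤ M ^ (n + 1) :=
      ((norm_pow_le x n).trans (pow_le_pow_left₀ (norm_nonneg _) hx n)).trans
        (pow_le_pow_right₀ hM n.le_succ)
    calc ‖x ^ (n + 1) - z ^ (n + 1)‖
        ≤ ‖x ^ n‖ * ‖x - z‖ + ‖x ^ n - z ^ n‖ * ‖z‖ := by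
          rw [telescope]
          exact (norm_add_le _ _).trans (add_le_add (norm_mul_le _ _) (norm_mul_le _ _))
      _ ≤ M ^ (n + 1) * ‖x - z‖ + (n * M ^ n * ‖x - z‖) * M := by gcongr
      _ = ((n + 1 : ℕ) : ℝ) * M ^ (n + 1) * ‖x - z‖ := by
          push_cast
          ring

variable [NormedAlgebra ℝ 𝔸]

theorem norm_le_exp_of_norm_smul_sub_one_le [NormOneClass 𝔸] {x : 𝔸} {n : ℕ}
    (hn : 0 < n) {C : ℝ} (h : ‖(n : ℝ) • (x - 1)‖ ≤ C) : ‖x‖ ≤ Real.exp (C / n) := by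
  rw [norm_smul, Real.norm_natCast] at h
  calc ‖x‖ ≤ ‖x - 1‖ + 1 := by simpa using norm_add_le (x - 1) 1
    _ ≤ C / n + 1 := by gcongr; rwa [le_div_iff₀' (by positivity)]
    _ ≤ Real.exp (C / n) := Real.add_one_le_exp _

variable [CompleteSpace 𝔸]

theorem tendsto_smul_exp_inv_smul_sub_one (y : 𝔸) :
    Tendsto (fun n : ℕ => (n : ℝ) • (NormedSpace.exp ((n : ℝ)⁻¹ • y) - 1)) atTop (𝓝 y) := by
  have hasDerivAt_exp : HasDerivAt (fun t : ℝ => NormedSpace.exp (t • y)) y 0 := by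
    simpa using hasDerivAt_exp_smul_const (𝕂 := ℝ) y (0 : ℝ)
  have tendsto_inv : Tendsto (fun n : ℕ => (n : ℝ)⁻¹) atTop (𝓝[≠] 0) :=
    (tendsto_inv_atTop_nhdsGT_zero.mono_right (nhdsGT_le_nhdsNE 0)).comp
      tendsto_natCast_atTop_atTop
  simpa [Function.comp_def, slope] using hasDerivAt_exp.tendsto_slope.comp tendsto_inv

theorem tendsto_pow_exp_of_tendsto_smul_sub_one [NormOneClass 𝔸] {x : ℕ → 𝔸}
    {y : 𝔸} (h : Tendsto (fun n : ℕ => (n : ℝ) • (x n - 1)) atTop (𝓝 y)) :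
    Tendsto (fun n => x n ^ n) atTop (𝓝 (NormedSpace.exp y)) := by
  have : NormedAlgebra ℚ 𝔸 := NormedAlgebra.restrictScalars ℚ ℝ 𝔸
  let z (n : ℕ) : 𝔸 := NormedSpace.exp ((n : ℝ)⁻¹ • y)
  have pow_z {n : ℕ} (hn : 0 < n) : z n ^ n = NormedSpace.exp y := by
    rw [← NormedSpace.exp_nsmul, ← Nat.cast_smul_eq_nsmul ℝ, smul_inv_smul₀]
    exact_mod_cast hn.ne'
  have tendsto_z := tendsto_smul_exp_inv_smul_sub_one y
  obtain ⟨C₁, norm_x_le⟩ := h.norm.isBoundedUnder_le.eventually_le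
  obtain ⟨C₂, norm_z_le⟩ := tendsto_z.norm.isBoundedUnder_le.eventually_le
  let C := max (max C₁ C₂) 0
  have tendsto_diff :
      Tendsto (fun n : ℕ => Real.exp C * ‖(n : ℝ) • (x n - z n)‖) atTop (𝓝 0) := by
    simpa [← smul_sub] using (h.sub tendsto_z).norm.const_mul (Real.exp C)
  rw [tendsto_iff_norm_sub_tendsto_zero]
  refine squeeze_zero' (Eventually.of_forall fun _ => norm_nonneg _) ?_ tendsto_diff
  filter_upwards [norm_x_le, norm_z_le, eventually_gt_atTop 0] with n hx hz hn
  have one_le_exp : 1 ≤ Real.exp (C / n) :=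
    Real.one_le_exp (div_nonneg (le_max_right _ _) n.cast_nonneg)
  have hxC : ‖x n‖ ≤ Real.exp (C / n) := norm_le_exp_of_norm_smul_sub_one_le hn
    (hx.trans ((le_max_left _ _).trans (le_max_left _ _)))
  have hzC : ‖z n‖ ≤ Real.exp (C / n) := norm_le_exp_of_norm_smul_sub_one_le hn
    (hz.trans ((le_max_right _ _).trans (le_max_left _ _)))
  calc ‖x n ^ n - NormedSpace.exp y‖ = ‖x n ^ n - z n ^ n‖ := by rw [pow_z hn]
    _ ≤ n * Real.exp (C / n) ^ n * ‖x n - z n‖ := norm_pow_sub_pow_le one_le_exp hxC hzC n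
    _ = Real.exp C * ‖(n : ℝ) • (x n - z n)‖ := by
        rw [← Real.exp_nat_mul, mul_div_cancel₀ _ (by exact_mod_cast hn.ne'), norm_smul,
          Real.norm_natCast]
        ring

end PowerLimit

section MatrixPower

variable {ι : Type*} [Fintype ι] [DecidableEq ι]

attribute [local instance] Matrix.linftyOpNormedRing Matrix.linftyOpNormedAlgebra

theorem tendsto_matrix_pow_apply_exp {K : ℕ → Matrix ι ι ℂ} {M : Matrix ι ι ℂ}
    (h : ∀ x y, Tendsto (fun n : ℕ => (n : ℂ) * (K n x y - (1 : Matrix ι ι ℂ) x y)) atTop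
      (𝓝 (M x y))) (a b : ι) :
    Tendsto (fun n => (K n ^ n) a b) atTop (𝓝 (NormedSpace.exp M a b)) := by
  have : Nonempty ι := ⟨a⟩
  have tendsto_smul_sub_one : Tendsto (fun n : ℕ => (n : ℝ) • (K n - 1)) atTop (𝓝 M) :=
    tendsto_pi_nhds.2 fun x => tendsto_pi_nhds.2 fun y => by simpa using h x y
  exact tendsto_pi_nhds.1 (tendsto_pi_nhds.1
    (tendsto_pow_exp_of_tendsto_smul_sub_one tendsto_smul_sub_one) a) b

theorem hasSum_matrix_exp_apply (M : Matrix ι ι ℂ) (a b : ι) :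
    HasSum (fun N : ℕ => ((N.factorial : ℂ))⁻¹ * (M ^ N) a b) (NormedSpace.exp M a b) := by
  have : NormedAlgebra ℚ (Matrix ι ι ℂ) := NormedAlgebra.restrictScalars ℚ ℝ _
  have hasSum_entry : HasSum (fun N : ℕ => ((N.factorial : ℂ)⁻¹ • M ^ N) a b)
      (NormedSpace.exp M a b) :=
    Pi.hasSum.1 (Pi.hasSum.1 (NormedSpace.exp_series_hasSum_exp' (𝕂 := ℂ) M) a) b
  simpa only [Matrix.smul_apply, smul_eq_mul] using hasSum_entry

/-- The path starting at `a` and then following the word `x`; its values after time `n` are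
irrelevant and set to `a`. -/
def wordPath {α : Type*} (a : α) {n : ℕ} (x : Fin n → α) : ℕ → α
  | 0 => a
  | i + 1 => if h : i < n then x ⟨i, h⟩ else a

theorem wordPath_snoc_of_le {α : Type*} (a : α) {n : ℕ} (x : Fin n → α) (y : α) {i : ℕ}
    (hi : i ≤ n) : wordPath a (Fin.snoc x y : Fin (n + 1) → α) i = wordPath a x i := by
  cases i with
  | zero => rfl
  | succ i =>
    have hlt : i < n := hi
    simp [wordPath, hlt, hlt.trans n.lt_succ_self, Fin.snoc]

theorem wordPath_snoc_last {α : Type*} (a : α) {n : ℕ} (x : Fin n → α) (y : α) :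
    wordPath a (Fin.snoc x y : Fin (n + 1) → α) (n + 1) = y := by
  simp [wordPath, Fin.snoc]

theorem prod_wordPath_snoc {α R : Type*} [CommMonoid R] (K : α → α → R) (a : α) {n : ℕ}
    (x : Fin n → α) (y : α) :
    ∏ i ∈ Finset.range (n + 1), K (wordPath a (Fin.snoc x y : Fin (n + 1) → α) i)
      (wordPath a (Fin.snoc x y : Fin (n + 1) → α) (i + 1)) =
    (∏ i ∈ Finset.range n, K (wordPath a x i) (wordPath a x (i + 1))) * K (wordPath a x n) y := by
  rw [Finset.prod_range_succ, wordPath_snoc_last, wordPath_snoc_of_le a x y le_rfl]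
  congr 1
  refine Finset.prod_congr rfl fun i hi => ?_
  have hlt := Finset.mem_range.1 hi
  rw [wordPath_snoc_of_le a x y hlt.le, wordPath_snoc_of_le a x y hlt]

theorem sum_prod_wordPath_eq_pow {R : Type*} [CommSemiring R] (K : Matrix ι ι R) (a b : ι)
    (n : ℕ) :
    ∑ x : Fin n → ι, (if wordPath a x n = b then
      ∏ i ∈ Finset.range n, K (wordPath a x i) (wordPath a x (i + 1)) else 0) = (K ^ n) a b := by
  induction n generalizing b with
  | zero => simp [wordPath, Matrix.one_apply]
  | succ n ih =>
    calc _ = ∑ y, ∑ x : Fin n → ι, (if y = b then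
          (∏ i ∈ Finset.range n, K (wordPath a x i) (wordPath a x (i + 1))) *
            K (wordPath a x n) y else 0) := by
          rw [← (Fin.snocEquiv fun _ => ι).sum_comp, Fintype.sum_prod_type]
          refine Finset.sum_congr rfl fun y _ => Finset.sum_congr rfl fun x _ => ?_
          exact if_congr (iff_of_eq (congrArg (· = b) (wordPath_snoc_last a x y)))
            (prod_wordPath_snoc K a x y) rfl
      _ = ∑ x : Fin n → ι,
          (∏ i ∈ Finset.range n, K (wordPath a x i) (wordPath a x (i + 1))) *
            K (wordPath a x n) b := by
          rw [Finset.sum_comm]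
          simp only [Finset.sum_ite_eq', Finset.mem_univ, if_true]
      _ = (K ^ (n + 1)) a b := by
          simp only [pow_succ, Matrix.mul_apply, ← ih, Finset.sum_mul, ite_mul, zero_mul]
          rw [Finset.sum_comm]
          simp only [Finset.sum_ite_eq, Finset.mem_univ, if_true]

end MatrixPower

section Grid

theorem tendsto_div_natCast (T : ℝ≥0) : Tendsto (fun n : ℕ => T / (n : ℝ≥0)) atTop (𝓝 0) := by
  rw [← NNReal.tendsto_coe]
  simpa using tendsto_const_div_atTop_nhds_zero_nat (T : ℝ)

theorem tendsto_div_natCast_nhdsGT {T : ℝ≥0} (hT : 0 < T) :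
    Tendsto (fun n : ℕ => T / (n : ℝ≥0)) atTop (𝓝[>] 0) := by
  refine tendsto_nhdsWithin_iff.2 ⟨tendsto_div_natCast T, ?_⟩
  filter_upwards [eventually_gt_atTop 0] with n hn
  exact div_pos hT (by exact_mod_cast hn)

theorem natCast_mul_div_self (T : ℝ≥0) {n : ℕ} (hn : 0 < n) : (n : ℝ≥0) * (T / n) = T :=
  mul_div_cancel₀ T (by exact_mod_cast hn.ne')

theorem natCast_mul_div_le (T : ℝ≥0) {i n : ℕ} (hi : i ≤ n) : (i : ℝ≥0) * (T / n) ≤ T := by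
  rcases n.eq_zero_or_pos with rfl | hn
  · simp
  · calc (i : ℝ≥0) * (T / n) ≤ n * (T / n) := by gcongr
      _ = T := natCast_mul_div_self T hn

/-- The first point of the grid `i T / n` (`i ∈ ℕ`) which is at least `s`. Sampling a
right-continuous path at this point converges to the value at `s`. -/
def gridCeil (T : ℝ≥0) (n : ℕ) (s : ℝ≥0) : ℝ≥0 := (⌈s * n / T⌉₊ : ℝ≥0) * (T / n)

theorem le_gridCeil {T : ℝ≥0} (hT : 0 < T) {n : ℕ} (hn : 0 < n) (s : ℝ≥0) :
    s ≤ gridCeil T n s := by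
  have : (0 : ℝ≥0) < n := by exact_mod_cast hn
  calc s = (s * n / T) * (T / n) := by field_simp
    _ ≤ gridCeil T n s := mul_le_mul_left (Nat.le_ceil _) _

theorem gridCeil_le {T : ℝ≥0} (hT : 0 < T) {n : ℕ} (hn : 0 < n) (s : ℝ≥0) :
    gridCeil T n s ≤ s + T / n := by
  have : (0 : ℝ≥0) < n := by exact_mod_cast hn
  calc gridCeil T n s ≤ (s * n / T + 1) * (T / n) :=
        mul_le_mul_left (Nat.ceil_lt_add_one zero_le).le _
    _ = s + T / n := by field_simp

theorem tendsto_gridCeil {T : ℝ≥0} (hT : 0 < T) (s : ℝ≥0) :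
    Tendsto (fun n => gridCeil T n s) atTop (𝓝[≥] s) := by
  have eventually_le : ∀ᶠ n in atTop, s ≤ gridCeil T n s := by
    filter_upwards [eventually_gt_atTop 0] with n hn using le_gridCeil hT hn s
  have tendsto_upper : Tendsto (fun n : ℕ => s + T / (n : ℝ≥0)) atTop (𝓝 s) := by
    simpa using (tendsto_div_natCast T).const_add s
  refine tendsto_nhdsWithin_iff.2 ⟨?_, eventually_le⟩
  refine tendsto_of_tendsto_of_tendsto_of_le_of_le' tendsto_const_nhds tendsto_upper
    eventually_le ?_
  filter_upwards [eventually_gt_atTop 0] with n hn using gridCeil_le hT hn s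

theorem ceil_mul_natCast_div_le {T : ℝ≥0} (n : ℕ) {s : ℝ≥0} (hs : s ≤ T) :
    ⌈s * n / T⌉₊ ≤ n := by
  refine Nat.ceil_le.2 (div_le_of_le_mul₀ zero_le zero_le ?_)
  rw [mul_comm]
  gcongr

theorem gridCeil_eq {T : ℝ≥0} (hT : 0 < T) {n : ℕ} (hn : 0 < n) (i : ℕ) {s : ℝ≥0}
    (hlt : i * (T / n) < s) (hle : s ≤ (i + 1 : ℕ) * (T / n)) :
    gridCeil T n s = (i + 1 : ℕ) * (T / n) := by
  have hn' : (0 : ℝ≥0) < n := by exact_mod_cast hn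
  have ceil_eq : ⌈s * n / T⌉₊ = i + 1 := by
    refine (Nat.ceil_eq_iff i.succ_ne_zero).2 ⟨?_, ?_⟩
    · rw [Nat.succ_sub_one, lt_div_iff₀ hT]
      calc (i : ℝ≥0) * T = i * (T / n) * n := by field_simp
        _ < s * n := mul_lt_mul_of_pos_right hlt hn'
    · rw [div_le_iff₀ hT]
      calc s * n ≤ (i + 1 : ℕ) * (T / n) * n := mul_le_mul_left hle _
        _ = (i + 1 : ℕ) * T := by field_simp
  rw [gridCeil, ceil_eq]

theorem measurable_comp_gridCeil {E : Type*} [MeasurableSpace E] (T : ℝ≥0) (n : ℕ)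
    (f : ℝ≥0 → E) : Measurable fun s : ℝ => f (gridCeil T n s.toNNReal) := by
  have measurable_ceil : Measurable fun s : ℝ => ⌈s.toNNReal * n / T⌉₊ :=
    Nat.measurable_ceil.comp (by fun_prop)
  exact (measurable_from_nat (f := fun k : ℕ => f ((k : ℝ≥0) * (T / n)))).comp measurable_ceil

theorem intervalIntegrable_comp_gridCeil (T : ℝ≥0) (n : ℕ) {f : ℝ≥0 → ℝ} {C : ℝ}
    (hf : ∀ s, ‖f s‖ ≤ C) (u v : ℝ) :
    IntervalIntegrable (fun s : ℝ => f (gridCeil T n s.toNNReal)) volume u v :=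
  (intervalIntegrable_const (c := C)).mono_fun'
    (measurable_comp_gridCeil T n f).aestronglyMeasurable (ae_of_all _ fun _ => hf _)

theorem integral_comp_gridCeil_cell {T : ℝ≥0} (hT : 0 < T) {n : ℕ} (hn : 0 < n) (f : ℝ≥0 → ℝ)
    (i : ℕ) :
    ∫ s in ((i : ℝ) * (T / n))..((i + 1 : ℕ) * (T / n)), f (gridCeil T n s.toNNReal) =
      (T / n : ℝ) * f ((i + 1 : ℕ) * (T / n)) := by
  have endpoints_le : (i : ℝ) * (T / n) ≤ ((i + 1 : ℕ) : ℝ) * (T / n) := by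
    gcongr
    exact i.le_succ
  rw [intervalIntegral.integral_congr_ae (g := fun _ => f ((i + 1 : ℕ) * (T / n))),
    intervalIntegral.integral_const, smul_eq_mul]
  · push_cast
    ring
  · refine ae_of_all _ fun s hs => ?_
    rw [Set.uIoc_of_le endpoints_le] at hs
    have hs₀ : (0 : ℝ) ≤ s := (by positivity : (0 : ℝ) ≤ (i : ℝ) * (T / n)).trans hs.1.le
    rw [gridCeil_eq hT hn i]
    · rw [← NNReal.coe_lt_coe, Real.coe_toNNReal s hs₀]
      exact_mod_cast hs.1
    · rw [← NNReal.coe_le_coe, Real.coe_toNNReal s hs₀]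
      exact_mod_cast hs.2

theorem integral_comp_gridCeil {T : ℝ≥0} (hT : 0 < T) {n : ℕ} (hn : 0 < n) {f : ℝ≥0 → ℝ} {C : ℝ}
    (hf : ∀ s, ‖f s‖ ≤ C) :
    ∫ s in (0 : ℝ)..T, f (gridCeil T n s.toNNReal) =
      ∑ i ∈ Finset.range n, (T / n : ℝ) * f ((i + 1 : ℕ) * (T / n)) := by
  have sum_cells := intervalIntegral.sum_integral_adjacent_intervals (n := n)
    (a := fun i : ℕ => (i : ℝ) * (T / n))
    (fun i _ => intervalIntegrable_comp_gridCeil T n hf _ _)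
  have first_eq : ((0 : ℕ) : ℝ) * (T / n) = 0 := by simp
  have last_eq : (n : ℝ) * (T / n) = T := by exact_mod_cast natCast_mul_div_self T hn
  rw [first_eq, last_eq] at sum_cells
  rw [← sum_cells]
  exact Finset.sum_congr rfl fun i _ => integral_comp_gridCeil_cell hT hn f i

variable {Λ : Type*} {T : ℝ≥0} {ξ : ℝ≥0 → Λ}

theorem tendsto_riemann_sum [DecidableEq Λ] (hT : 0 < T)
    (hξ : ∀ t, ∀ᶠ s in 𝓝[≥] t, ξ s = ξ t) (z : Λ) :
    Tendsto (fun n : ℕ => ∑ i ∈ Finset.range n,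
      (T / n : ℝ) * (if ξ ((i + 1 : ℕ) * (T / n)) = z then 1 else 0)) atTop
      (𝓝 (∫ s in (0 : ℝ)..T, if ξ s.toNNReal = z then 1 else 0)) := by
  let f (s : ℝ≥0) : ℝ := if ξ s = z then 1 else 0
  have norm_f_le : ∀ s, ‖f s‖ ≤ 1 := fun s => by
    simp only [f]
    split_ifs <;> simp
  have tendsto_sample (s : ℝ≥0) : Tendsto (fun n => f (gridCeil T n s)) atTop (𝓝 (f s)) := by
    refine tendsto_const_nhds.congr' ?_
    filter_upwards [(tendsto_gridCeil hT s).eventually (hξ s)] with n hn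
    simp only [f, hn]
  have tendsto_integral :=
    intervalIntegral.tendsto_integral_filter_of_dominated_convergence
      (μ := volume) (a := (0 : ℝ)) (b := T) (l := atTop)
      (F := fun (n : ℕ) (s : ℝ) => f (gridCeil T n s.toNNReal)) (f := fun s => f s.toNNReal)
      (fun _ => 1)
      (Eventually.of_forall fun n => (measurable_comp_gridCeil T n f).aestronglyMeasurable)
      (Eventually.of_forall fun n => ae_of_all _ fun s _ => norm_f_le _)
      intervalIntegrable_const (ae_of_all _ fun s _ => tendsto_sample s.toNNReal)
  refine tendsto_integral.congr' ?_
  filter_upwards [eventually_gt_atTop 0] with n hn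
  exact integral_comp_gridCeil hT hn norm_f_le

theorem eventually_exists_grid_notMem (hT : 0 < T) (hξ : ∀ t, ∀ᶠ s in 𝓝[≥] t, ξ s = ξ t)
    {S : Set Λ} {s : ℝ≥0} (hs : s ≤ T) (hsS : ξ s ∉ S) :
    ∀ᶠ n : ℕ in atTop, ∃ i ≤ n, ξ (i * (T / n)) ∉ S := by
  filter_upwards [(tendsto_gridCeil hT s).eventually (hξ s)] with n hn
  rw [gridCeil] at hn
  exact ⟨⌈s * n / T⌉₊, ceil_mul_natCast_div_le n hs, by rwa [hn]⟩

end Grid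

section GridMatrix

variable {Λ ι : Type*}

/-- The one-step matrix of the chain sampled at mesh `h`, restricted to the image of `e` and
weighted by the characters `exp (i h v_y)` whose products approximate `exp (i ∑ v_y ℓ_T(y))`. -/
def gridMatrix (p : ℝ≥0 → Matrix Λ Λ ℝ) (e : ι → Λ) (v : ι → ℝ) (h : ℝ≥0) : Matrix ι ι ℂ :=
  Matrix.of fun x y => (p h (e x) (e y) : ℂ) * Complex.exp (Complex.I * h * v y)

/-- The matrix `A + diag (i v)`, restricted to the image of `e`: the generator of the chain killed
outside of the image of `e`, with the Feynman-Kac potential `i v`. -/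
def feynmanKacMatrix [DecidableEq ι] (A : Matrix Λ Λ ℝ) (e : ι → Λ) (v : ι → ℝ) : Matrix ι ι ℂ :=
  (A.submatrix e e).map Complex.ofReal + Matrix.diagonal fun y => Complex.I * v y

theorem feynmanKacMatrix_submatrix_val [DecidableEq ι] (A : Matrix Λ Λ ℝ) (e : ι → Λ) (v : ι → ℝ)
    (S : Finset ι) :
    (feynmanKacMatrix A e v).submatrix (fun x : S => (x : ι)) (fun x : S => (x : ι)) =
      feynmanKacMatrix A (fun x : S => e x) fun x : S => v x := by
  ext x y
  rcases eq_or_ne x y with rfl | hxy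
  · simp [feynmanKacMatrix]
  · simp [feynmanKacMatrix, hxy, Subtype.coe_injective.ne hxy]

theorem tendsto_cexp_sub_one_div (z : ℂ) :
    Tendsto (fun h : ℝ≥0 => (Complex.exp (Complex.I * h * z) - 1) / (h : ℂ)) (𝓝[>] 0)
      (𝓝 (Complex.I * z)) := by
  have hasDerivAt_cexp :
      HasDerivAt (fun t : ℂ => Complex.exp (Complex.I * t * z)) (Complex.I * z) 0 := by
    simpa using (((hasDerivAt_id (0 : ℂ)).const_mul Complex.I).mul_const z).cexp
  have tendsto_coe : Tendsto (fun h : ℝ≥0 => ((h : ℝ) : ℂ)) (𝓝[>] 0) (𝓝[≠] 0) := by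
    refine tendsto_nhdsWithin_iff.2 ⟨?_, ?_⟩
    · exact (Continuous.tendsto' (by fun_prop) _ _ (by simp)).mono_left nhdsWithin_le_nhds
    · filter_upwards [self_mem_nhdsWithin] with h (hh : 0 < h)
      simpa using hh.ne'
  simpa [Function.comp_def, slope_def_field] using hasDerivAt_cexp.tendsto_slope.comp tendsto_coe

theorem HasGenerator.tendsto_gridMatrix [DecidableEq Λ] [DecidableEq ι]
    {p : ℝ≥0 → Matrix Λ Λ ℝ} {A : Matrix Λ Λ ℝ} (hp : HasGenerator p A) {e : ι → Λ}
    (he : Function.Injective e) (v : ι → ℝ) (x y : ι) :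
    Tendsto (fun h : ℝ≥0 => (gridMatrix p e v h x y - (1 : Matrix ι ι ℂ) x y) / (h : ℂ))
      (𝓝[>] 0) (𝓝 (feynmanKacMatrix A e v x y)) := by
  have one_apply : (((1 : Matrix Λ Λ ℝ) (e x) (e y) : ℝ) : ℂ) = (1 : Matrix ι ι ℂ) x y := by
    simp only [Matrix.one_apply, he.eq_iff]
    split_ifs <;> simp
  have tendsto_increment : Tendsto (fun h : ℝ≥0 =>
      ((p h (e x) (e y) : ℂ) - (1 : Matrix ι ι ℂ) x y) / (h : ℂ)) (𝓝[>] 0)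
      (𝓝 (A (e x) (e y) : ℂ)) := by
    simpa [Function.comp_def, one_apply] using
      (Complex.continuous_ofReal.tendsto _).comp (hp (e x) (e y))
  have tendsto_cexp : Tendsto (fun h : ℝ≥0 => Complex.exp (Complex.I * h * v y)) (𝓝[>] 0)
      (𝓝 1) :=
    (Continuous.tendsto' (by fun_prop) _ _ (by simp)).mono_left nhdsWithin_le_nhds
  have tendsto_sum := (tendsto_increment.mul tendsto_cexp).add
    ((tendsto_cexp_sub_one_div (v y)).const_mul ((1 : Matrix ι ι ℂ) x y))
  have limit_eq : (A (e x) (e y) : ℂ) * 1 + (1 : Matrix ι ι ℂ) x y * (Complex.I * v y) =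
      feynmanKacMatrix A e v x y := by
    rcases eq_or_ne x y with rfl | hxy
    · simp [feynmanKacMatrix]
    · simp [feynmanKacMatrix, hxy]
  rw [← limit_eq]
  refine tendsto_sum.congr fun h => ?_
  simp only [gridMatrix, Matrix.of_apply]
  ring

theorem tendsto_natCast_mul_of_tendsto_div {f : ℝ≥0 → ℂ} {z : ℂ}
    (hf : Tendsto (fun h : ℝ≥0 => f h / (h : ℂ)) (𝓝[>] 0) (𝓝 z)) {T : ℝ≥0} (hT : 0 < T) :
    Tendsto (fun n : ℕ => (n : ℂ) * f (T / n)) atTop (𝓝 (T * z)) := by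
  refine ((hf.comp (tendsto_div_natCast_nhdsGT hT)).const_mul (T : ℂ)).congr' ?_
  filter_upwards [eventually_gt_atTop 0] with n hn
  have hn' : (n : ℂ) ≠ 0 := by exact_mod_cast hn.ne'
  have hT' : ((T : ℝ) : ℂ) ≠ 0 := by exact_mod_cast hT.ne'
  simp only [Function.comp_apply, NNReal.coe_div, NNReal.coe_natCast, Complex.ofReal_div,
    Complex.ofReal_natCast]
  field_simp

theorem HasGenerator.tendsto_gridMatrix_pow [DecidableEq Λ] [Fintype ι] [DecidableEq ι]
    {p : ℝ≥0 → Matrix Λ Λ ℝ} {A : Matrix Λ Λ ℝ} (hp : HasGenerator p A) {e : ι → Λ}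
    (he : Function.Injective e) (v : ι → ℝ) {T : ℝ≥0} (hT : 0 < T) (a b : ι) :
    Tendsto (fun n : ℕ => (gridMatrix p e v (T / n) ^ n) a b) atTop
      (𝓝 (NormedSpace.exp ((T : ℂ) • feynmanKacMatrix A e v) a b)) :=
  tendsto_matrix_pow_apply_exp (fun x y =>
    tendsto_natCast_mul_of_tendsto_div (hp.tendsto_gridMatrix he v x y) hT) a b

end GridMatrix

section GridEvent

variable {Λ Ω ι : Type*} {X : ℝ≥0 → Ω → Λ} {T : ℝ≥0} {e : ι → Λ} {a : ι} {n : ℕ} {ω : Ω}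

/-- The event that the chain follows the path `a, x 0, …, x (n - 1)` along the grid `i T / n`,
states in the image of `e` being labelled by `ι`. -/
def gridEvent (X : ℝ≥0 → Ω → Λ) (T : ℝ≥0) (e : ι → Λ) (a : ι) {n : ℕ} (x : Fin n → ι) : Set Ω :=
  {ω | ∀ i ≤ n, X (i * (T / n)) ω = e (wordPath a x i)}

theorem measurableSet_gridEvent [MeasurableSpace Ω] (hX : ∀ t x, MeasurableSet {ω | X t ω = x})
    (T : ℝ≥0) (e : ι → Λ) (a : ι) (x : Fin n → ι) : MeasurableSet (gridEvent X T e a x) := by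
  have gridEvent_eq : gridEvent X T e a x = ⋂ i ∈ Finset.range (n + 1),
      {ω | X (i * (T / n)) ω = e (wordPath a x i)} := by
    ext ω
    simp [gridEvent]
  rw [gridEvent_eq]
  exact Finset.measurableSet_biInter _ fun i _ => hX _ _

theorem exists_mem_gridEvent (start : X 0 ω = e a)
    (h : ∀ i ≤ n, X (i * (T / n)) ω ∈ Set.range e) : ∃ w : Fin n → ι, ω ∈ gridEvent X T e a w := by
  choose w hw using fun i : Fin n => h (i + 1) i.2
  refine ⟨w, fun i hi => ?_⟩
  cases i with
  | zero => simpa [wordPath] using start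
  | succ i =>
    have hlt : i < n := hi
    simp only [wordPath, hlt, dite_true, hw ⟨i, hlt⟩]

theorem eq_of_mem_gridEvent (he : Function.Injective e) {w x : Fin n → ι}
    (hw : ω ∈ gridEvent X T e a w) (hx : ω ∈ gridEvent X T e a x) : x = w := by
  funext i
  simpa [wordPath] using he ((hx (i + 1) i.2).symm.trans (hw (i + 1) i.2))

theorem eq_of_mem_gridEvent_last (hn : 0 < n) {x : Fin n → ι} (hx : ω ∈ gridEvent X T e a x) :
    X T ω = e (wordPath a x n) := by
  simpa only [natCast_mul_div_self T hn] using hx n le_rfl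

end GridEvent

section GridFunctional

variable {Λ Ω ι : Type*} [Fintype ι] {X : ℝ≥0 → Ω → Λ} {T : ℝ≥0} {e : ι → Λ} {a : ι} {n : ℕ}
  {ω : Ω}

theorem norm_exp_sum_mul_I (t v : ι → ℝ) :
    ‖Complex.exp (∑ y, (t y : ℂ) * (Complex.I * v y))‖ = 1 := by
  have exponent_eq :
      ∑ y, (t y : ℂ) * (Complex.I * v y) = ((∑ y, t y * v y : ℝ) : ℂ) * Complex.I := by
    push_cast
    rw [Finset.sum_mul]
    exact Finset.sum_congr rfl fun y _ => by ring
  rw [exponent_eq, Complex.norm_exp_ofReal_mul_I]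

theorem prod_cexp_gridEvent [DecidableEq Λ] (he : Function.Injective e) (v : ι → ℝ)
    {w : Fin n → ι} (hw : ω ∈ gridEvent X T e a w) :
    ∏ i ∈ Finset.range n, Complex.exp (Complex.I * (T / n) * v (wordPath a w (i + 1))) =
      Complex.exp (∑ y, ((∑ i ∈ Finset.range n,
        (T / n : ℝ) * (if X ((i + 1 : ℕ) * (T / n)) ω = e y then 1 else 0) : ℝ) : ℂ) *
          (Complex.I * v y)) := by
  classical
  rw [← Complex.exp_sum]
  congr 1
  simp only [Complex.ofReal_sum, Finset.sum_mul]
  rw [Finset.sum_comm]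
  refine Finset.sum_congr rfl fun i hi => ?_
  have eq_iff (y : ι) : X ((i + 1 : ℕ) * (T / n)) ω = e y ↔ wordPath a w (i + 1) = y := by
    rw [hw (i + 1) (Finset.mem_range.1 hi), he.eq_iff]
  simp only [eq_iff, mul_ite, mul_one, mul_zero, apply_ite Complex.ofReal, Complex.ofReal_zero,
    ite_mul, zero_mul, Finset.sum_ite_eq, Finset.mem_univ, if_true]
  push_cast
  ring

variable [DecidableEq ι]

/-- The grid approximation of `exp (i ∑ v_y ℓ_T(y))` on the event that the chain stays in the image
of `e` and ends in `e b`. It is expanded over the words followed along the grid, so that its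
expectation is read off the finite-dimensional distributions. -/
def gridFunctional (X : ℝ≥0 → Ω → Λ) (T : ℝ≥0) (e : ι → Λ) (v : ι → ℝ) (a b : ι) (n : ℕ) (ω : Ω) :
    ℂ :=
  ∑ x : Fin n → ι, (gridEvent X T e a x).indicator (fun _ => if wordPath a x n = b then
    ∏ i ∈ Finset.range n, Complex.exp (Complex.I * (T / n) * v (wordPath a x (i + 1))) else 0) ω

theorem gridFunctional_eq_zero (v : ι → ℝ) {b : ι} (hn : 0 < n)
    (h : ¬ ((∀ i ≤ n, X (i * (T / n)) ω ∈ Set.range e) ∧ X T ω = e b)) :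
    gridFunctional X T e v a b n ω = 0 := by
  refine Finset.sum_eq_zero fun x _ => ?_
  by_cases hx : ω ∈ gridEvent X T e a x
  · rw [Set.indicator_of_mem hx, if_neg]
    rintro rfl
    exact h ⟨fun i hi => ⟨_, (hx i hi).symm⟩, eq_of_mem_gridEvent_last hn hx⟩
  · exact Set.indicator_of_notMem hx _

theorem eventually_gridFunctional_eq_zero (hT : 0 < T) (v : ι → ℝ) (a : ι) {b : ι}
    (hω : ∀ t, ∀ᶠ s in 𝓝[≥] t, X s ω = X t ω)
    (h : ¬ (X T ω = e b ∧ chainRange X T ω ⊆ Set.range e)) :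
    ∀ᶠ n in atTop, gridFunctional X T e v a b n ω = 0 := by
  rcases not_and_or.1 h with hb | not_subset
  · filter_upwards [eventually_gt_atTop 0] with n hn
    exact gridFunctional_eq_zero v hn fun h' => hb h'.2
  · obtain ⟨_, ⟨s, hs, rfl⟩, hsS⟩ := Set.not_subset.1 not_subset
    filter_upwards [eventually_gt_atTop 0,
      eventually_exists_grid_notMem hT (ξ := fun s => X s ω) hω hs.2 hsS] with n hn ⟨i, hi, hiS⟩
    exact gridFunctional_eq_zero v hn fun h' => hiS (h'.1 i hi)

theorem gridFunctional_eq [DecidableEq Λ] (he : Function.Injective e) (v : ι → ℝ) {b : ι}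
    (hn : 0 < n) (start : X 0 ω = e a) (h : ∀ i ≤ n, X (i * (T / n)) ω ∈ Set.range e)
    (hb : X T ω = e b) :
    gridFunctional X T e v a b n ω = Complex.exp (∑ y, ((∑ i ∈ Finset.range n,
      (T / n : ℝ) * (if X ((i + 1 : ℕ) * (T / n)) ω = e y then 1 else 0) : ℝ) : ℂ) *
        (Complex.I * v y)) := by
  obtain ⟨w, hw⟩ := exists_mem_gridEvent start h
  have last_eq : wordPath a w n = b := he ((eq_of_mem_gridEvent_last hn hw).symm.trans hb)
  rw [gridFunctional, Finset.sum_eq_single w, Set.indicator_of_mem hw, if_pos last_eq,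
    prod_cexp_gridEvent he v hw]
  · exact fun x _ hx =>
      Set.indicator_of_notMem (fun hmem => hx (eq_of_mem_gridEvent he hw hmem)) _
  · simp

theorem norm_gridFunctional_le (he : Function.Injective e) (v : ι → ℝ) (b : ι) (hn : 0 < n)
    (start : X 0 ω = e a) : ‖gridFunctional X T e v a b n ω‖ ≤ 1 := by
  classical
  by_cases h : (∀ i ≤ n, X (i * (T / n)) ω ∈ Set.range e) ∧ X T ω = e b
  · rw [gridFunctional_eq he v hn start h.1 h.2, norm_exp_sum_mul_I]
  · rw [gridFunctional_eq_zero v hn h]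
    simp

section Measurability

variable [MeasurableSpace Ω]

theorem measurable_gridFunctional (hX : ∀ t x, MeasurableSet {ω | X t ω = x}) (T : ℝ≥0)
    (e : ι → Λ) (v : ι → ℝ) (a b : ι) (n : ℕ) : Measurable (gridFunctional X T e v a b n) :=
  Finset.measurable_fun_sum _ fun x _ =>
    measurable_const.indicator (measurableSet_gridEvent hX T e a x)

theorem integral_gridFunctional {P : Measure Ω} [IsFiniteMeasure P]
    (hX : ∀ t x, MeasurableSet {ω | X t ω = x}) {p : ℝ≥0 → Matrix Λ Λ ℝ} (e : ι → Λ) (a : ι)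
    (hp : ∀ (n : ℕ) (t : ℕ → ℝ≥0) (x : ℕ → Λ), Monotone t → t 0 = 0 → x 0 = e a →
      P.real {ω | ∀ i ≤ n, X (t i) ω = x i} =
        ∏ i ∈ Finset.range n, p (t (i + 1) - t i) (x i) (x (i + 1)))
    (T : ℝ≥0) (v : ι → ℝ) (b : ι) (n : ℕ) :
    ∫ ω, gridFunctional X T e v a b n ω ∂P = (gridMatrix p e v (T / n) ^ n) a b := by
  have prob_gridEvent (x : Fin n → ι) : P.real (gridEvent X T e a x) =
      ∏ i ∈ Finset.range n, p (T / n) (e (wordPath a x i)) (e (wordPath a x (i + 1))) := by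
    rw [gridEvent, hp n (fun i => i * (T / n)) (fun i => e (wordPath a x i))
      (fun i j hij => mul_le_mul_left (by exact_mod_cast hij) _) (by simp) rfl]
    refine Finset.prod_congr rfl fun i _ => ?_
    rw [← tsub_mul, Nat.cast_succ, add_tsub_cancel_left, one_mul]
  simp only [gridFunctional]
  rw [← sum_prod_wordPath_eq_pow, integral_finsetSum _ fun x _ =>
    (integrable_const _).indicator (measurableSet_gridEvent hX T e a x)]
  refine Finset.sum_congr rfl fun x _ => ?_
  rw [integral_indicator (measurableSet_gridEvent hX T e a x), setIntegral_const, prob_gridEvent]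
  split_ifs
  · simp [gridMatrix, Finset.prod_mul_distrib]
  · simp

end Measurability

end GridFunctional

section RangeFunctional

variable {Λ Ω ι : Type*} [Fintype ι] {X : ℝ≥0 → Ω → Λ} {T : ℝ≥0} {e : ι → Λ}

/-- The functional `exp (i ∑ v_y ℓ_T(y))` on the event that the chain ends in `b` and its range
satisfies `p`. The two instances of interest are `range ⊆ S`, where it is a limit of grid
approximations, and `range = S`, which is obtained from these by inclusion-exclusion. -/
def rangeFunctional [DecidableEq Λ] (X : ℝ≥0 → Ω → Λ) (T : ℝ≥0) (e : ι → Λ) (v : ι → ℝ) (b : Λ)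
    (p : Set Λ → Prop) : Ω → ℂ :=
  Set.indicator {ω | X T ω = b ∧ p (chainRange X T ω)} fun ω =>
    Complex.exp (∑ y, (localTime X T (e y) ω : ℂ) * (Complex.I * v y))

variable [DecidableEq Λ]

theorem norm_rangeFunctional_le (X : ℝ≥0 → Ω → Λ) (T : ℝ≥0) (e : ι → Λ) (v : ι → ℝ) (b : Λ)
    (p : Set Λ → Prop) (ω : Ω) : ‖rangeFunctional X T e v b p ω‖ ≤ 1 :=
  (norm_indicator_le_norm_self _ _).trans (norm_exp_sum_mul_I _ _).le

variable [DecidableEq ι]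

theorem tendsto_gridFunctional_of_range_subset (hT : 0 < T) (he : Function.Injective e)
    (v : ι → ℝ) {a b : ι} {ω : Ω} (start : X 0 ω = e a)
    (hω : ∀ t, ∀ᶠ s in 𝓝[≥] t, X s ω = X t ω) (hb : X T ω = e b)
    (range_subset : chainRange X T ω ⊆ Set.range e) :
    Tendsto (fun n => gridFunctional X T e v a b n ω) atTop
      (𝓝 (Complex.exp (∑ y, (localTime X T (e y) ω : ℂ) * (Complex.I * v y)))) := by
  have tendsto_riemann : Tendsto (fun n : ℕ => Complex.exp (∑ y, ((∑ i ∈ Finset.range n,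
      (T / n : ℝ) * (if X ((i + 1 : ℕ) * (T / n)) ω = e y then 1 else 0) : ℝ) : ℂ) *
      (Complex.I * v y))) atTop
      (𝓝 (Complex.exp (∑ y, (localTime X T (e y) ω : ℂ) * (Complex.I * v y)))) := by
    refine (Complex.continuous_exp.tendsto _).comp (tendsto_finsetSum _ fun y _ => ?_)
    exact ((Complex.continuous_ofReal.tendsto _).comp
      (tendsto_riemann_sum hT (ξ := fun s => X s ω) hω (e y))).mul_const _
  refine tendsto_riemann.congr' ?_
  filter_upwards [eventually_gt_atTop 0] with n hn
  exact (gridFunctional_eq he v hn start (fun i hi => range_subset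
    ⟨i * (T / n), ⟨zero_le, natCast_mul_div_le T hi⟩, rfl⟩) hb).symm

theorem tendsto_gridFunctional (hT : 0 < T) (he : Function.Injective e) (v : ι → ℝ) {a : ι} (b : ι)
    {ω : Ω} (start : X 0 ω = e a) (hω : ∀ t, ∀ᶠ s in 𝓝[≥] t, X s ω = X t ω) :
    Tendsto (fun n => gridFunctional X T e v a b n ω) atTop
      (𝓝 (rangeFunctional X T e v (e b) (· ⊆ Set.range e) ω)) := by
  by_cases h : X T ω = e b ∧ chainRange X T ω ⊆ Set.range e
  · rw [rangeFunctional, Set.indicator_of_mem (by exact h)]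
    exact tendsto_gridFunctional_of_range_subset hT he v start hω h.1 h.2
  · rw [rangeFunctional, Set.indicator_of_notMem (by exact h)]
    exact tendsto_const_nhds.congr'
      ((eventually_gridFunctional_eq_zero hT v a hω h).mono fun _ => Eq.symm)

end RangeFunctional

namespace IsMarkovChain

variable {Λ Ω ι : Type*} [DecidableEq Λ] [MeasurableSpace Ω] {P : Measure Ω}
  [IsProbabilityMeasure P] {A : Matrix Λ Λ ℝ} {X : ℝ≥0 → Ω → Λ}

theorem ae_start {a : Λ} (hX : IsMarkovChain P A a X) : ∀ᵐ ω ∂P, X 0 ω = a := by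
  obtain ⟨p, -, -, hfdd⟩ := hX.markov
  have prob_start := hfdd 0 (fun _ => 0) (fun _ => a) monotone_const rfl rfl
  simp only [nonpos_iff_eq_zero, forall_eq, Finset.range_zero, Finset.prod_empty] at prob_start
  rw [ae_iff, ← Set.compl_ofPred, prob_compl_eq_zero_iff (hX.measurable 0 a)]
  rwa [measureReal_def, ENNReal.toReal_eq_one_iff] at prob_start

variable [Fintype ι] {e : ι → Λ} {a : ι} {T : ℝ≥0}

theorem ae_tendsto_gridFunctional [DecidableEq ι] (hX : IsMarkovChain P A (e a) X)
    (he : Function.Injective e) (hT : 0 < T) (v : ι → ℝ) (b : ι) :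
    ∀ᵐ ω ∂P, Tendsto (fun n => gridFunctional X T e v a b n ω) atTop
      (𝓝 (rangeFunctional X T e v (e b) (· ⊆ Set.range e) ω)) := by
  filter_upwards [hX.ae_start, hX.right_continuous] with ω start hω
  exact tendsto_gridFunctional hT he v b start hω

theorem integrable_rangeFunctional_subset (hX : IsMarkovChain P A (e a) X)
    (he : Function.Injective e) (hT : 0 < T) (v : ι → ℝ) (b : ι) :
    Integrable (rangeFunctional X T e v (e b) (· ⊆ Set.range e)) P := by
  classical
  exact Integrable.of_bound (aestronglyMeasurable_of_tendsto_ae atTop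
    (fun n => (measurable_gridFunctional hX.measurable T e v a b n).aestronglyMeasurable)
    (hX.ae_tendsto_gridFunctional he hT v b)) 1
    (ae_of_all _ (norm_rangeFunctional_le X T e v (e b) _))

/-- A Feynman-Kac formula: the characteristic function of the local times of the chain killed
outside of the image of `e` is a matrix exponential, here in the form of its power series. -/
theorem hasSum_integral_rangeFunctional_subset [DecidableEq ι] (hX : IsMarkovChain P A (e a) X)
    (he : Function.Injective e) (hT : 0 < T) (v : ι → ℝ) (b : ι) :
    HasSum (fun N : ℕ => (T : ℂ) ^ N / N.factorial * (feynmanKacMatrix A e v ^ N) a b)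
      (∫ ω, rangeFunctional X T e v (e b) (· ⊆ Set.range e) ω ∂P) := by
  obtain ⟨p, -, hgen, hfdd⟩ := hX.markov
  have norm_le : ∀ᶠ n in atTop, ∀ᵐ ω ∂P, ‖gridFunctional X T e v a b n ω‖ ≤ 1 := by
    filter_upwards [eventually_gt_atTop 0] with n hn
    filter_upwards [hX.ae_start] with ω start
    exact norm_gridFunctional_le he v b hn start
  have tendsto_integral := tendsto_integral_filter_of_dominated_convergence (fun _ => (1 : ℝ))
    (Eventually.of_forall fun n =>
      (measurable_gridFunctional hX.measurable T e v a b n).aestronglyMeasurable)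
    norm_le (integrable_const 1) (hX.ae_tendsto_gridFunctional he hT v b)
  simp only [integral_gridFunctional hX.measurable e a hfdd] at tendsto_integral
  rw [tendsto_nhds_unique tendsto_integral (hgen.tendsto_gridMatrix_pow he v hT a b)]
  convert hasSum_matrix_exp_apply _ a b using 2 with N
  rw [smul_pow, Matrix.smul_apply, smul_eq_mul, div_eq_inv_mul, mul_assoc]

end IsMarkovChain

section RangeDecomposition

variable {Λ Ω ι : Type*} [DecidableEq Λ] {X : ℝ≥0 → Ω → Λ} {T : ℝ≥0} {e : ι → Λ} {ω : Ω}

theorem localTime_eq_zero {z : Λ} (h : z ∉ chainRange X T ω) : localTime X T z ω = 0 := by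
  refine intervalIntegral.integral_zero_ae (ae_of_all _ fun s hs => ?_)
  rw [Set.uIoc_of_le T.coe_nonneg] at hs
  exact if_neg fun hz => h ⟨s.toNNReal, ⟨zero_le, Real.toNNReal_le_iff_le_coe.2 hs.2⟩, hz⟩

variable [Fintype ι]

theorem rangeFunctional_subtype_eq (he : Function.Injective e) (v : ι → ℝ) (S : Finset ι) (b : Λ) :
    rangeFunctional X T (fun x : S => e x) (fun x : S => v x) b
        (· ⊆ Set.range fun x : S => e x) =
      rangeFunctional X T e v b (· ⊆ e '' S) := by
  have range_eq : (Set.range fun x : S => e x) = e '' S := by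
    ext z
    simp
  rw [range_eq]
  refine Set.indicator_congr (f := fun ω => Complex.exp
    (∑ y : S, (localTime X T (e y) ω : ℂ) * (Complex.I * v y))) fun ω hω => ?_
  beta_reduce
  congr 1
  rw [Finset.sum_coe_sort S fun y => (localTime X T (e y) ω : ℂ) * (Complex.I * v y)]
  refine Finset.sum_subset S.subset_univ fun y _ hy => ?_
  rw [localTime_eq_zero fun hmem => hy (he.mem_set_image.1 (hω.2 hmem)), Complex.ofReal_zero,
    zero_mul]

theorem rangeFunctional_subset_eq_sum (he : Function.Injective e) (v : ι → ℝ) (S : Finset ι)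
    (b : Λ) (ω : Ω) :
    rangeFunctional X T e v b (· ⊆ e '' S) ω =
      ∑ S' ∈ S.powerset, rangeFunctional X T e v b (· = e '' S') ω := by
  classical
  by_cases h : X T ω = b ∧ chainRange X T ω ⊆ e '' S
  · obtain ⟨S₀, hS₀, range_eq⟩ : ∃ S₀ ⊆ S, chainRange X T ω = e '' S₀ := by
      obtain ⟨S₀, hS₀, image_eq⟩ := Set.subset_image_iff.1 h.2
      lift S₀ to Finset ι using Set.toFinite S₀
      exact ⟨S₀, Finset.coe_subset.1 hS₀, image_eq.symm⟩
    rw [Finset.sum_eq_single_of_mem S₀ (Finset.mem_powerset.2 hS₀), rangeFunctional,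
      Set.indicator_of_mem (by exact h), rangeFunctional,
      Set.indicator_of_mem (by exact ⟨h.1, range_eq⟩)]
    refine fun S' _ hne => Set.indicator_of_notMem (fun hmem => hne ?_) _
    exact Finset.coe_injective (he.image_injective (hmem.2.symm.trans range_eq))
  · rw [rangeFunctional, Set.indicator_of_notMem (by exact h)]
    refine (Finset.sum_eq_zero fun S' hS' =>
      Set.indicator_of_notMem (fun hmem => h ⟨hmem.1, ?_⟩) _).symm
    exact hmem.2.trans_subset (Set.image_mono (Finset.coe_subset.2 (Finset.mem_powerset.1 hS')))

theorem rangeFunctional_eq_sub_sum [DecidableEq ι] (he : Function.Injective e) (v : ι → ℝ)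
    (S : Finset ι) (b : Λ) (ω : Ω) :
    rangeFunctional X T e v b (· = e '' S) ω = rangeFunctional X T e v b (· ⊆ e '' S) ω -
      ∑ S' ∈ S.ssubsets, rangeFunctional X T e v b (· = e '' S') ω := by
  rw [rangeFunctional_subset_eq_sum he, ← Finset.add_sum_erase _ _ (Finset.mem_powerset_self S)]
  exact (add_sub_cancel_right _ _).symm

end RangeDecomposition

namespace IsMarkovChain

variable {Λ Ω ι : Type*} [DecidableEq Λ] [MeasurableSpace Ω] {P : Measure Ω}
  [IsProbabilityMeasure P] {A : Matrix Λ Λ ℝ} {X : ℝ≥0 → Ω → Λ} [Fintype ι] {e : ι → Λ} {a b : ι}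
  {T : ℝ≥0}

theorem rangeFunctional_ae_eq_zero (hX : IsMarkovChain P A (e a) X) (he : Function.Injective e)
    (v : ι → ℝ) {S : Finset ι} (hab : ¬ (a ∈ S ∧ b ∈ S)) :
    rangeFunctional X T e v (e b) (· = e '' S) =ᵐ[P] 0 := by
  filter_upwards [hX.ae_start] with ω start
  refine Set.indicator_of_notMem (fun hmem => hab ?_) _
  have range_eq : chainRange X T ω = e '' S := hmem.2
  have ha_mem : e a ∈ e '' S := range_eq ▸ ⟨0, ⟨le_rfl, zero_le⟩, start⟩
  have hb_mem : e b ∈ e '' S := range_eq ▸ ⟨T, ⟨zero_le, le_rfl⟩, hmem.1⟩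
  exact ⟨he.mem_set_image.1 ha_mem, he.mem_set_image.1 hb_mem⟩

theorem integrable_rangeFunctional_image (hX : IsMarkovChain P A (e a) X)
    (he : Function.Injective e) (hT : 0 < T) (v : ι → ℝ) (b : ι) (S : Finset ι) :
    Integrable (rangeFunctional X T e v (e b) (· = e '' S)) P := by
  classical
  induction S using Finset.strongInduction with
  | H S ih =>
  by_cases hab : a ∈ S ∧ b ∈ S
  · have integrable_subset : Integrable (rangeFunctional X T e v (e b) (· ⊆ e '' S)) P := by
      rw [← rangeFunctional_subtype_eq he]
      exact integrable_rangeFunctional_subset (e := fun x : S => e x) (a := ⟨a, hab.1⟩) hX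
        (he.comp Subtype.val_injective) hT (fun x : S => v x) ⟨b, hab.2⟩
    rw [funext (rangeFunctional_eq_sub_sum he v S (e b))]
    exact integrable_subset.sub
      (integrable_finsetSum _ fun S' hS' => ih S' (Finset.mem_ssubsets.1 hS'))
  · exact (integrable_zero _ _ _).congr (hX.rangeFunctional_ae_eq_zero he v hab).symm

variable [DecidableEq ι]

/-- Inclusion-exclusion over the range: `coveringWeight` satisfies the same recursion over the
subsets of `S` as the characteristic functions of the local times. -/
theorem hasSum_integral_rangeFunctional_image (hX : IsMarkovChain P A (e a) X)
    (he : Function.Injective e) (hT : 0 < T) (v : ι → ℝ) (b : ι) (S : Finset ι) :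
    HasSum (fun N : ℕ => (T : ℂ) ^ N / N.factorial *
      coveringWeight (feynmanKacMatrix A e v) S N a b)
      (∫ ω, rangeFunctional X T e v (e b) (· = e '' S) ω ∂P) := by
  induction S using Finset.strongInduction with
  | H S ih =>
  by_cases hab : a ∈ S ∧ b ∈ S
  · have hasSum_subset := hasSum_integral_rangeFunctional_subset (e := fun x : S => e x)
      (a := ⟨a, hab.1⟩) hX (he.comp Subtype.val_injective) hT (fun x : S => v x) ⟨b, hab.2⟩
    rw [rangeFunctional_subtype_eq he, ← feynmanKacMatrix_submatrix_val] at hasSum_subset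
    simp only [rangeFunctional_subset_eq_sum he, ← sum_powerset_coveringWeight] at hasSum_subset
    rw [integral_finsetSum _ fun S' _ => hX.integrable_rangeFunctional_image he hT v b S']
      at hasSum_subset
    have hasSum_sub := hasSum_subset.sub
      (hasSum_sum fun S' hS' => ih S' (Finset.mem_ssubsets.1 hS'))
    simp only [← Finset.mul_sum, ← mul_sub] at hasSum_sub
    simpa only [← Finset.add_sum_erase _ _ (Finset.mem_powerset_self S), Finset.ssubsets,
      add_sub_cancel_right] using hasSum_sub
  · rw [integral_congr_ae (hX.rangeFunctional_ae_eq_zero he v hab)]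
    simp [coveringWeight, hab]

/-- Both sides are sums of the same power series in the time. -/
theorem integral_rangeFunctional_eq (hX : IsMarkovChain P A (e a) X) (he : Function.Injective e)
    (hT : 0 < T) (v : ι → ℝ) (b : ι) :
    ∫ ω, rangeFunctional X T e v (e b) (· = Set.range e) ω ∂P =
      ∫ l, Complex.exp (∑ y, (l y : ℂ) * (Complex.I * v y)) *
        entireDensity ((A.submatrix e e).map Complex.ofReal) a b l ∂simplexMeasure a T := by
  have hasSum_chain := hX.hasSum_integral_rangeFunctional_image he hT v b Finset.univ
  have hasSum_density :=
    hasSum_integral_entireDensity (feynmanKacMatrix A e v) a b a (NNReal.coe_pos.2 hT)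
  simp only [feynmanKacMatrix, entireDensity_add_diagonal] at hasSum_chain hasSum_density
  simpa using hasSum_chain.unique hasSum_density

end IsMarkovChain

section Uniqueness

variable {ι : Type*} [Fintype ι]

theorem continuous_exp_sum_mul_I (v : ι → ℝ) :
    Continuous fun l : ι → ℝ => Complex.exp (∑ y, (l y : ℂ) * (Complex.I * v y)) := by
  fun_prop

theorem measure_ext_of_integral_exp_sum_mul_I {μ ν : Measure (ι → ℝ)} [IsFiniteMeasure μ]
    [IsFiniteMeasure ν]
    (h : ∀ v : ι → ℝ, ∫ l, Complex.exp (∑ y, (l y : ℂ) * (Complex.I * v y)) ∂μ =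
      ∫ l, Complex.exp (∑ y, (l y : ℂ) * (Complex.I * v y)) ∂ν) : μ = ν := by
  classical
  refine Measure.ext_of_charFunDual (funext fun L => ?_)
  have apply_eq_sum (l : ι → ℝ) : L l = ∑ y, l y * L (Pi.single y 1) := by
    conv_lhs => rw [pi_eq_sum_univ' l, map_sum]
    simp
  have exponent_eq (l : ι → ℝ) :
      (L l : ℂ) * Complex.I = ∑ y, (l y : ℂ) * (Complex.I * (L (Pi.single y 1) : ℝ)) := by
    rw [apply_eq_sum]
    push_cast
    rw [Finset.sum_mul]
    exact Finset.sum_congr rfl fun y _ => by ring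
  simpa only [charFunDual_apply, exponent_eq] using h fun y => L (Pi.single y 1)

theorem integral_exp_sum_mul_I_neg (σ : Measure (ι → ℝ)) (v : ι → ℝ) (r : (ι → ℝ) → ℝ) :
    ∫ l, Complex.exp (∑ y, (l y : ℂ) * (Complex.I * (-v) y)) * (r l : ℂ) ∂σ =
      starRingEnd ℂ (∫ l, Complex.exp (∑ y, (l y : ℂ) * (Complex.I * v y)) * (r l : ℂ) ∂σ) := by
  rw [← integral_conj]
  refine integral_congr_ae (ae_of_all _ fun l => ?_)
  simp [← Complex.exp_conj]

section Density

variable {α : Type*} [MeasurableSpace α] {σ : Measure α}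

theorem integral_withDensity_ofReal {f : α → ℝ} (hf : AEMeasurable f σ) (g : α → ℂ) :
    ∫ l, g l ∂(σ.withDensity fun l => ENNReal.ofReal (f l)) =
      ∫ l, g l * (max (f l) 0 : ℝ) ∂σ := by
  rw [integral_withDensity_eq_integral_toReal_smul₀ hf.ennreal_ofReal
    (ae_of_all _ fun _ => ENNReal.ofReal_lt_top)]
  refine integral_congr_ae (ae_of_all _ fun l => ?_)
  simp only [ENNReal.toReal_ofReal', Complex.real_smul, mul_comm]

theorem integral_withDensity_ofReal_sub_neg {f : α → ℝ} (hf : Integrable f σ) {g : α → ℂ}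
    (hg : AEStronglyMeasurable g σ) {C : ℝ} (hC : ∀ l, ‖g l‖ ≤ C) :
    ∫ l, g l ∂(σ.withDensity fun l => ENNReal.ofReal (f l)) -
        ∫ l, g l ∂(σ.withDensity fun l => ENNReal.ofReal (-f l)) =
      ∫ l, g l * (f l : ℂ) ∂σ := by
  rw [integral_withDensity_ofReal hf.1.aemeasurable,
    integral_withDensity_ofReal (f := fun l => -f l) hf.1.aemeasurable.neg, ← integral_sub]
  · refine integral_congr_ae (ae_of_all _ fun l => ?_)
    beta_reduce
    rw [← mul_sub, ← Complex.ofReal_sub, max_zero_sub_max_neg_zero_eq_self]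
  · exact hf.pos_part.ofReal.bdd_mul hg (ae_of_all _ hC)
  · exact hf.neg_part.ofReal.bdd_mul hg (ae_of_all _ hC)

theorem integral_mul_eq_integral_mul_re_add_im {ρ g : α → ℂ} (hρ : Integrable ρ σ)
    (hg : AEStronglyMeasurable g σ) {C : ℝ} (hC : ∀ l, ‖g l‖ ≤ C) :
    ∫ l, g l * ρ l ∂σ =
      ∫ l, g l * ((ρ l).re : ℂ) ∂σ + (∫ l, g l * ((ρ l).im : ℂ) ∂σ) * Complex.I := by
  have integrable_re : Integrable (fun l => g l * ((ρ l).re : ℂ)) σ :=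
    hρ.re.ofReal.bdd_mul hg (ae_of_all _ hC)
  have integrable_im : Integrable (fun l => g l * ((ρ l).im : ℂ)) σ :=
    hρ.im.ofReal.bdd_mul hg (ae_of_all _ hC)
  rw [← integral_mul_const, ← integral_add integrable_re (integrable_im.mul_const _)]
  refine integral_congr_ae (ae_of_all _ fun l => ?_)
  beta_reduce
  rw [mul_assoc, ← mul_add]
  exact congrArg (g l * ·) (Complex.re_add_im (ρ l)).symm

end Density

theorem integral_eq_of_charFun_eq_ofReal {μ σ : Measure (ι → ℝ)} [IsFiniteMeasure μ]
    {f : (ι → ℝ) → ℝ} (hf : Integrable f σ)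
    (h : ∀ v : ι → ℝ, ∫ l, Complex.exp (∑ y, (l y : ℂ) * (Complex.I * v y)) ∂μ =
      ∫ l, Complex.exp (∑ y, (l y : ℂ) * (Complex.I * v y)) * (f l : ℂ) ∂σ)
    {F : (ι → ℝ) → ℂ} (hF : Measurable F) {C : ℝ} (hC : ∀ l, ‖F l‖ ≤ C) :
    ∫ l, F l ∂μ = ∫ l, F l * (f l : ℂ) ∂σ := by
  set σ_pos := σ.withDensity fun l => ENNReal.ofReal (f l)
  set σ_neg := σ.withDensity fun l => ENNReal.ofReal (-f l)
  have : IsFiniteMeasure σ_pos := isFiniteMeasure_withDensity_ofReal hf.2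
  have : IsFiniteMeasure σ_neg := isFiniteMeasure_withDensity_ofReal hf.neg.2
  have integrable_of_bounded {G : (ι → ℝ) → ℂ} (hG : Measurable G) {C : ℝ} (hC : ∀ l, ‖G l‖ ≤ C)
      (τ : Measure (ι → ℝ)) [IsFiniteMeasure τ] : Integrable G τ :=
    .of_bound hG.aestronglyMeasurable C (ae_of_all _ hC)
  have measure_eq : μ + σ_neg = σ_pos := by
    refine measure_ext_of_integral_exp_sum_mul_I fun v => ?_
    have measurable_exp := (continuous_exp_sum_mul_I v).measurable
    have exp_bound := fun l => (norm_exp_sum_mul_I l v).le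
    rw [integral_add_measure (integrable_of_bounded measurable_exp exp_bound _)
      (integrable_of_bounded measurable_exp exp_bound _), h,
      ← integral_withDensity_ofReal_sub_neg hf measurable_exp.aestronglyMeasurable exp_bound,
      sub_add_cancel]
  rw [← integral_withDensity_ofReal_sub_neg hf hF.aestronglyMeasurable hC]
  change _ = ∫ l, F l ∂σ_pos - ∫ l, F l ∂σ_neg
  rw [← measure_eq, integral_add_measure (integrable_of_bounded hF hC _)
    (integrable_of_bounded hF hC _), add_sub_cancel_right]

theorem integral_eq_of_charFun_eq {μ σ : Measure (ι → ℝ)} [IsFiniteMeasure μ]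
    {ρ : (ι → ℝ) → ℂ} (hρ : Integrable ρ σ)
    (h : ∀ v : ι → ℝ, ∫ l, Complex.exp (∑ y, (l y : ℂ) * (Complex.I * v y)) ∂μ =
      ∫ l, Complex.exp (∑ y, (l y : ℂ) * (Complex.I * v y)) * ρ l ∂σ)
    {F : (ι → ℝ) → ℂ} (hF : Measurable F) {C : ℝ} (hC : ∀ l, ‖F l‖ ≤ C) :
    ∫ l, F l ∂μ = ∫ l, F l * ρ l ∂σ := by
  have charFun_split (v : ι → ℝ) := (h v).trans <| integral_mul_eq_integral_mul_re_add_im hρ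
    (continuous_exp_sum_mul_I v).aestronglyMeasurable fun l => (norm_exp_sum_mul_I l v).le
  -- conjugating the identity at `-v` separates the real part of `ρ` from the imaginary part
  have charFun_split_conj (v : ι → ℝ) :
      ∫ l, Complex.exp (∑ y, (l y : ℂ) * (Complex.I * v y)) ∂μ =
        ∫ l, Complex.exp (∑ y, (l y : ℂ) * (Complex.I * v y)) * ((ρ l).re : ℂ) ∂σ -
          (∫ l, Complex.exp (∑ y, (l y : ℂ) * (Complex.I * v y)) * ((ρ l).im : ℂ) ∂σ) *
            Complex.I := by
    have integral_neg := integral_exp_sum_mul_I_neg μ v 1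
    simp only [Pi.one_apply, Complex.ofReal_one, mul_one] at integral_neg
    have conj_eq := congrArg (starRingEnd ℂ) (charFun_split (-v))
    rw [integral_neg, integral_exp_sum_mul_I_neg, integral_exp_sum_mul_I_neg] at conj_eq
    simpa [sub_eq_add_neg] using conj_eq
  have integral_re : ∫ l, F l ∂μ = ∫ l, F l * ((ρ l).re : ℂ) ∂σ :=
    integral_eq_of_charFun_eq_ofReal hρ.re (fun v => by
      linear_combination (charFun_split v + charFun_split_conj v) / 2) hF hC
  have integral_im : ∫ l, F l ∂(0 : Measure (ι → ℝ)) = ∫ l, F l * ((ρ l).im : ℂ) ∂σ :=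
    integral_eq_of_charFun_eq_ofReal hρ.im (fun v => by
      rw [integral_zero_measure]
      refine (mul_eq_zero.1 ?_).resolve_right Complex.I_ne_zero |>.symm
      linear_combination (charFun_split_conj v - charFun_split v) / 2) hF hC
  rw [integral_mul_eq_integral_mul_re_add_im hρ hF.aestronglyMeasurable hC, ← integral_re,
    ← integral_im, integral_zero_measure, zero_mul, add_zero]

end Uniqueness

namespace IsMarkovChain

variable {Λ Ω ι : Type*} [DecidableEq Λ] [MeasurableSpace Ω] {P : Measure Ω} {A : Matrix Λ Λ ℝ}
  {X : ℝ≥0 → Ω → Λ} {T : ℝ≥0}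

theorem aemeasurable_localTime {x : Λ} (hX : IsMarkovChain P A x X) (hT : 0 < T) (z : Λ) :
    AEMeasurable (localTime X T z) P := by
  refine aemeasurable_of_tendsto_metrizable_ae atTop (f := fun (n : ℕ) ω =>
    ∑ i ∈ Finset.range n, (T / n : ℝ) * (if X ((i + 1 : ℕ) * (T / n)) ω = z then 1 else 0))
    (fun n => Measurable.aemeasurable ?_) ?_
  · refine Finset.measurable_fun_sum _ fun i _ => Measurable.const_mul ?_ _
    exact Measurable.ite (hX.measurable _ z) measurable_const measurable_const
  · filter_upwards [hX.right_continuous] with ω right_continuous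
    exact tendsto_riemann_sum hT (ξ := fun s => X s ω) right_continuous z

variable [IsProbabilityMeasure P] {e : ι → Λ} {a : ι}

theorem nullMeasurableSet_range_eq [Finite ι] (hX : IsMarkovChain P A (e a) X)
    (he : Function.Injective e) (hT : 0 < T) (b : ι) :
    NullMeasurableSet {ω | X T ω = e b ∧ chainRange X T ω = Set.range e} P := by
  cases nonempty_fintype ι
  have aemeasurable := (hX.integrable_rangeFunctional_image he hT 0 b Finset.univ).1.aemeasurable
  convert aemeasurable.nullMeasurableSet_preimage (measurableSet_singleton (1 : ℂ)) using 1
  ext ω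
  simp [rangeFunctional, Set.indicator_apply]

theorem integral_localTime_eq [Fintype ι] [DecidableEq ι] (hX : IsMarkovChain P A (e a) X)
    (he : Function.Injective e) (hT : 0 < T) (b : ι) {F : (ι → ℝ) → ℂ} (hF : Measurable F) {C : ℝ}
    (hC : ∀ l, ‖F l‖ ≤ C) :
    ∫ ω, Set.indicator {ω | X T ω = e b ∧ chainRange X T ω = Set.range e}
        (fun ω => F fun y => localTime X T (e y) ω) ω ∂P =
      ∫ l, F l * entireDensity ((A.submatrix e e).map Complex.ofReal) a b l
        ∂simplexMeasure a T := by
  set E := {ω | X T ω = e b ∧ chainRange X T ω = Set.range e}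
  have aemeasurable_localTimes : AEMeasurable (fun ω (y : ι) => localTime X T (e y) ω) P :=
    aemeasurable_pi_lambda _ fun y => hX.aemeasurable_localTime hT (e y)
  have integral_eq_map {G : (ι → ℝ) → ℂ} (hG : Measurable G) :
      ∫ ω, E.indicator (fun ω => G fun y => localTime X T (e y) ω) ω ∂P =
        ∫ l, G l ∂((P.restrict E).map fun ω (y : ι) => localTime X T (e y) ω) := by
    rw [integral_map aemeasurable_localTimes.restrict hG.aestronglyMeasurable,
      integral_indicator₀ (hX.nullMeasurableSet_range_eq he hT b)]
  rw [integral_eq_map hF]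
  refine integral_eq_of_charFun_eq (integrable_entireDensity _ a b a T) (fun v => ?_) hF hC
  rw [← hX.integral_rangeFunctional_eq he hT v b,
    ← integral_eq_map (continuous_exp_sum_mul_I v).measurable]
  rfl

end IsMarkovChain

theorem ofReal_integral_indicator {Ω : Type*} [MeasurableSpace Ω] (P : Measure Ω) (E : Set Ω)
    (f : Ω → ℝ) :
    ((∫ ω, E.indicator f ω ∂P : ℝ) : ℂ) = ∫ ω, E.indicator (fun ω => (f ω : ℂ)) ω ∂P := by
  rw [← integral_complex_ofReal]
  congr 1 with ω
  exact (congrFun (E.indicator_comp_of_zero (g := Complex.ofReal) Complex.ofReal_zero) ω).symm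

section Density

variable {ι : Type*} [Fintype ι] [DecidableEq ι]

theorem density_ae_eq_entireDensity (A : Matrix ι ι ℝ) (a b c : ι) (T : ℝ) :
    density A a b =ᵐ[simplexMeasure c T] entireDensity (A.map Complex.ofReal) a b := by
  filter_upwards [ae_simplexMeasure_mem c T] with l hl
  exact density_eq_entireDensity A a b hl.1

theorem integrable_density (A : Matrix ι ι ℝ) (a b c : ι) (T : ℝ) :
    Integrable (density A a b) (simplexMeasure c T) :=
  (integrable_entireDensity _ a b c T).congr (density_ae_eq_entireDensity A a b c T).symm

theorem integral_mul_density (A : Matrix ι ι ℝ) (a b c : ι) (T : ℝ) (F : (ι → ℝ) → ℂ) :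
    ∫ l, F l * density A a b l ∂simplexMeasure c T =
      ∫ l, F l * entireDensity (A.map Complex.ofReal) a b l ∂simplexMeasure c T := by
  refine integral_congr_ae ?_
  filter_upwards [density_ae_eq_entireDensity A a b c T] with l hl
  rw [hl]

end Density

end LocalTimes

end

theorem theorem2p1_general {Λ : Type*} [DecidableEq Λ]
    {Ω : Type*} [MeasurableSpace Ω] (P : MeasureTheory.Measure Ω)
    [MeasureTheory.IsProbabilityMeasure P]
    (A : Matrix Λ Λ ℝ) (R : Finset Λ) (a b : R)
    (X : ℝ≥0 → Ω → Λ) (hX : LocalTimes.IsMarkovChain P A a X)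
    (T : ℝ≥0) (hT : 0 < T) :
    MeasureTheory.Integrable
      (LocalTimes.density (A.submatrix (fun x : R => (x : Λ)) (fun x : R => (x : Λ))) a b)
      (LocalTimes.simplexMeasure a T) ∧
    ∀ F : (R → ℝ) → ℝ, Measurable F → (∃ C, ∀ l, |F l| ≤ C) →
      ((∫ ω, Set.indicator {ω | X T ω = b ∧ LocalTimes.chainRange X T ω = (R : Set Λ)}
          (fun ω => F (fun x : R => LocalTimes.localTime X T x ω)) ω ∂P : ℝ) : ℂ) =
        ∫ l, (F l : ℂ) *
          LocalTimes.density (A.submatrix (fun x : R => (x : Λ)) (fun x : R => (x : Λ))) a b l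
          ∂(LocalTimes.simplexMeasure a T) := by
  refine ⟨LocalTimes.integrable_density _ a b a T, fun F hF ⟨C, hC⟩ => ?_⟩
  have law := hX.integral_localTime_eq Subtype.val_injective hT b
    (Complex.measurable_ofReal.comp hF) (C := C) fun l => by simpa using hC l
  rw [Subtype.range_coe] at law
  rw [LocalTimes.ofReal_integral_indicator, LocalTimes.integral_mul_density]
  exact law

theorem theorem2p1 {Λ : Type*} [Countable Λ] [DecidableEq Λ]
    {Ω : Type*} [MeasurableSpace Ω] (P : MeasureTheory.Measure Ω)
    [MeasureTheory.IsProbabilityMeasure P]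
    (A : Matrix Λ Λ ℝ) (hA : LocalTimes.IsConservativeGenerator A)
    (R : Finset Λ) (a b : R)
    (X : ℝ≥0 → Ω → Λ) (hX : LocalTimes.IsMarkovChain P A a X)
    (T : ℝ≥0) (hT : 0 < T) :
    MeasureTheory.Integrable
      (LocalTimes.density (A.submatrix (fun x : R => (x : Λ)) (fun x : R => (x : Λ))) a b)
      (LocalTimes.simplexMeasure a T) ∧
    ∀ F : (R → ℝ) → ℝ, Measurable F → (∃ C, ∀ l, |F l| ≤ C) →
      ((∫ ω, Set.indicator {ω | X T ω = b ∧ LocalTimes.chainRange X T ω = (R : Set Λ)}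
          (fun ω => F (fun x : R => LocalTimes.localTime X T x ω)) ω ∂P : ℝ) : ℂ) =
        ∫ l, (F l : ℂ) *
          LocalTimes.density (A.submatrix (fun x : R => (x : Λ)) (fun x : R => (x : Λ))) a b l
          ∂(LocalTimes.simplexMeasure a T) :=
  theorem2p1_general P A R a b X hX T hT
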